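/- Let $n,m\ge 1$ be integers, $T>0$, $x^0\in\mathbb{R}^n$, $\mathrm{U}\subset\mathbb{R}^m$ nonempty, and consider a control-affine system $\dot x(t)=f(x(t),u(t),t)$ for a.e. $t\in[0,T]$, $x(0)=x^0$, i.e. $f(x,u,t)=g(x,t)+B(x,t)u$ on $\mathbb{R}^n\times\mathbb{R}^m\times[0,T]$, where $g:\mathbb{R}^n\times[0,T]\to\mathbb{R}^n$ and $B:\mathbb{R}^n\times[0,T]\to\mathbb{R}^{n\times m}$ are continuous and have a partial differential with respect to $x$ that exists and is continuous on $\mathbb{R}^n\times[0,T]$. A control $u\in \mathrm{L}^\infty([0,T],\mathbb{R}^m)$ is admissible ($u\in\mathcal{U}$) if there is an absolutely continuous $x_u:[0,T]\to\mathbb{R}^n$ (it is then unique) with $x_u(0)=x^0$ and $\dot x_u(t)=f(x_u(t),u(t),t)$ for a.e. $t\in[0,T]$. The end-point mapping is $\mathrm{E}:\mathcal{U}\to\mathbb{R}^n$, $\mathrm{E}(u)=x_u(T)$; $\mathcal{U}$ is open in $\mathrm{L}^\infty([0,T],\mathbb{R}^m)$ and $\mathrm{DE}(u)$ denotes the Fréchet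 differential. For a subset $\mathrm{V}$ of $\mathbb{R}^m$, $\mathrm{L}^\infty([0,T],\mathrm{V})$ is the set of $u\in \mathrm{L}^\infty([0,T],\mathbb{R}^m)$ with $u(t)\in \mathrm{V}$ for a.e. $t$. * $u\in\mathcal{U}$ is strongly regular if $\mathrm{DE}(u)$ is surjective. * For convex $\mathrm{V}$, $u\in\mathcal{U}\cap \mathrm{L}^\infty([0,T],\mathrm{V})$ is strongly $\mathrm{V}$-regular if $\mathrm{DE}(u)$ maps the cone $\mathbb{R}_+(\mathrm{L}^\infty([0,T],\mathrm{V})-u)$ onto $\mathbb{R}^n$. * $u\in\mathcal{U}\cap \mathrm{L}^\infty([0,T],\mathrm{U})$ is weakly $\mathrm{U}$-regular if the smallest convex cone containing all the vectors $w_{(\tau,\omega)}(T)$ is $\mathbb{R}^n$, where $\omega\in \mathrm{U}$, $\tau\in[0,T)$ is a Lebesgue point of $t\mapsto f(x_u(t),u(t),t)$, and $w_{(\tau,\omega)}$ is the absolutely continuous solution on $[\tau,T]$ of $\dot w(t)=\nabla_x f(x_u(t),u(t),t)\,w(t)$ a.e., $w(\tau)=f(x_u(\tau),\omega,\tau)-f(x_u(\tau),u(\tau),\tau)$.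 Then, for every $u\in\mathcal{U}\cap \mathrm{L}^\infty([0,T],\mathrm{U})$: (i) if $u$ is strongly $\mathrm{conv}(\mathrm{U})$-regular, where $\mathrm{conv}(\mathrm{U})$ is the convex hull of $\mathrm{U}$, then $u$ is weakly $\mathrm{U}$-regular; (ii) if $u$ is weakly $\mathrm{U}$-regular, then $u$ is strongly regular; (iii) when $\mathrm{U}$ is convex, $u$ is weakly $\mathrm{U}$-regular if and only if $u$ is strongly $\mathrm{U}$-regular. The converse of (ii) is not true in general: there exist a control-affine system, a set $\mathrm{U}$ and a control $u\in\mathcal{U}\cap \mathrm{L}^\infty([0,T],\mathrm{U})$, for some $n,m,T,x^0$ as above, such that $u$ is strongly regular but not weakly $\mathrm{U}$-regular. -/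

import Mathlib

open MeasureTheory Filter Topology Set
open scoped ENNReal

noncomputable section

namespace ControlSystem

/-- `ℝᵏ` with its Euclidean structure. -/
abbrev Euc (k : ℕ) : Type := EuclideanSpace ℝ (Fin k)

/-- The Banach space `L^∞([0,T], ℝᵐ)` of (classes of) essentially bounded controls. -/
abbrev Ctrl (m : ℕ) (T : ℝ) : Type :=
  Lp (Euc m) ∞ ((volume : Measure ℝ).restrict (Icc 0 T))

variable {n m : ℕ}

/-- `φ(x,t)` is continuous on `E × [0,T]` and of class `C¹` with respect to its first variable:
the partial differential exists and is continuous as a function of `(x,t)` in `E × [0,T]`. -/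
def IsC1InFst {E F : Type*} [NormedAddCommGroup E] [NormedSpace ℝ E]
    [NormedAddCommGroup F] [NormedSpace ℝ F] (T : ℝ) (φ : E → ℝ → F) : Prop :=
  ContinuousOn (fun q : E × ℝ => φ q.1 q.2) (univ ×ˢ Icc 0 T) ∧
  (∀ t ∈ Icc (0 : ℝ) T, Differentiable ℝ fun x => φ x t) ∧
  ContinuousOn (fun q : E × ℝ => fderiv ℝ (fun x => φ x q.2) q.1) (univ ×ˢ Icc 0 T)

/-- The dynamics is control-affine on `[0,T]`: `f(x,u,t) = g(x,t) + B(x,t) u`, with `g` and `B`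
continuous and of class `C¹` with respect to `x`. Matrices are seen as linear maps. -/
def IsControlAffine (T : ℝ) (f : Euc n → Euc m → ℝ → Euc n) : Prop :=
  ∃ (g : Euc n → ℝ → Euc n) (B : Euc n → ℝ → (Euc m →L[ℝ] Euc n)),
    IsC1InFst T g ∧ IsC1InFst T B ∧
    ∀ x u, ∀ t ∈ Icc (0 : ℝ) T, f x u t = g x t + B x t u

/-- `x` is a trajectory on `[0,T]` associated with the control `u` and starting at `x0`: it is
absolutely continuous, `x(0) = x0`, and `x'(t) = f(x(t),u(t),t)` for a.e. `t ∈ [0,T]`. -/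
def IsTrajectory (f : Euc n → Euc m → ℝ → Euc n) (T : ℝ) (x0 : Euc n)
    (u : Ctrl m T) (x : ℝ → Euc n) : Prop :=
  AbsolutelyContinuousOnInterval x 0 T ∧ x 0 = x0 ∧
  ∀ᵐ t ∂((volume : Measure ℝ).restrict (Icc 0 T)), HasDerivAt x (f (x t) (u t) t) t

/-- The set of admissible controls. -/
def admissible (f : Euc n → Euc m → ℝ → Euc n) (T : ℝ) (x0 : Euc n) : Set (Ctrl m T) :=
  {u | ∃ x, IsTrajectory f T x0 u x}

open Classical in
/-- The trajectory `x_u` of an admissible control `u` (a trajectory is unique on `[0,T]` for the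
dynamics considered here; only its values on `[0,T]` are ever used). The zero function if `u` is
not admissible. -/
def trajectory (f : Euc n → Euc m → ℝ → Euc n) (T : ℝ) (x0 : Euc n) (u : Ctrl m T) :
    ℝ → Euc n :=
  if h : ∃ x, IsTrajectory f T x0 u x then h.choose else 0

/-- The end-point mapping `E(u) = x_u(T)` (the set of admissible controls being open, its
differential at an admissible control does not see the value given outside of that set). -/
def endpoint (f : Euc n → Euc m → ℝ → Euc n) (T : ℝ) (x0 : Euc n) (u : Ctrl m T) : Euc n :=
  trajectory f T x0 u T

/-- `L^∞([0,T], U)`: the controls with values in `U` almost everywhere. -/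
def ctrlIn (T : ℝ) (U : Set (Euc m)) : Set (Ctrl m T) :=
  {u | ∀ᵐ t ∂((volume : Measure ℝ).restrict (Icc 0 T)), u t ∈ U}

/-- The cone `ℝ₊ (L^∞([0,T],U) - u)`. -/
def ctrlTangentCone (T : ℝ) (U : Set (Euc m)) (u : Ctrl m T) : Set (Ctrl m T) :=
  {v | ∃ α : ℝ, 0 ≤ α ∧ ∃ w ∈ ctrlIn T U, v = α • (w - u)}

/-- An admissible control `u` is strongly regular if the Fréchet differential of the end-point
mapping at `u` is surjective. -/
def StronglyRegular (f : Euc n → Euc m → ℝ → Euc n) (T : ℝ) (x0 : Euc n)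
    (u : Ctrl m T) : Prop :=
  u ∈ admissible f T x0 ∧
  ∃ D : Ctrl m T →L[ℝ] Euc n, HasFDerivAt (endpoint f T x0) D u ∧ range D = univ

/-- An admissible control `u` with values in `U` is strongly `U`-regular (a notion used for convex
`U`) if the Fréchet differential of the end-point mapping at `u` maps the tangent cone
to `L^∞([0,T],U)` at `u` onto `ℝⁿ`. -/
def StronglyURegular (f : Euc n → Euc m → ℝ → Euc n) (T : ℝ) (x0 : Euc n)
    (U : Set (Euc m)) (u : Ctrl m T) : Prop :=
  u ∈ admissible f T x0 ∧ u ∈ ctrlIn T U ∧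
  ∃ D : Ctrl m T →L[ℝ] Euc n,
    HasFDerivAt (endpoint f T x0) D u ∧ D '' ctrlTangentCone T U u = univ

/-- The Lebesgue points in `[0,T)` of a function `φ` on `[0,T]`. -/
def lebesguePoints (T : ℝ) (φ : ℝ → Euc n) : Set ℝ :=
  {τ | τ ∈ Ico 0 T ∧
    Tendsto (fun r : ℝ => r⁻¹ * ∫ s in Icc (τ - r) (τ + r) ∩ Icc 0 T, ‖φ s - φ τ‖)
      (𝓝[>] 0) (𝓝 0)}

/-- The function `f_u(t) = f(x_u(t),u(t),t)`. -/
def velocity (f : Euc n → Euc m → ℝ → Euc n) (T : ℝ) (x0 : Euc n) (u : Ctrl m T) :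
    ℝ → Euc n :=
  fun t => f (trajectory f T x0 u t) (u t) t

/-- `w` is the variation attached to the needle `(τ,ω)`: it is absolutely continuous on `[τ,T]`,
`w'(t) = ∇ₓf(x_u(t),u(t),t) w(t)` for a.e. `t ∈ [τ,T]`, and
`w(τ) = f(x_u(τ),ω,τ) - f(x_u(τ),u(τ),τ)`. -/
def IsNeedleVariation (f : Euc n → Euc m → ℝ → Euc n) (T : ℝ) (x0 : Euc n)
    (u : Ctrl m T) (τ : ℝ) (ω : Euc m) (w : ℝ → Euc n) : Prop :=
  AbsolutelyContinuousOnInterval w τ T ∧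
  w τ = f (trajectory f T x0 u τ) ω τ - f (trajectory f T x0 u τ) (u τ) τ ∧
  ∀ᵐ t ∂((volume : Measure ℝ).restrict (Icc τ T)),
    HasDerivAt w (fderiv ℝ (fun y => f y (u t) t) (trajectory f T x0 u t) (w t)) t

/-- The strong `U`-variation vectors associated with `u`. -/
def strongVariationVectors (f : Euc n → Euc m → ℝ → Euc n) (T : ℝ) (x0 : Euc n)
    (U : Set (Euc m)) (u : Ctrl m T) : Set (Euc n) :=
  {z | ∃ τ ∈ lebesguePoints T (velocity f T x0 u), ∃ ω ∈ U, ∃ w : ℝ → Euc n,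
    IsNeedleVariation f T x0 u τ ω w ∧ z = w T}

/-- The `U`-Pontryagin cone of `u`: the smallest convex cone containing all the strong
`U`-variation vectors associated with `u`. -/
def pontryaginCone (f : Euc n → Euc m → ℝ → Euc n) (T : ℝ) (x0 : Euc n)
    (U : Set (Euc m)) (u : Ctrl m T) : PointedCone ℝ (Euc n) :=
  PointedCone.hull ℝ (strongVariationVectors f T x0 U u)

/-- An admissible control `u` with values in `U` is weakly `U`-regular if its `U`-Pontryagin cone
is the whole of `ℝⁿ`. -/
def WeaklyURegular (f : Euc n → Euc m → ℝ → Euc n) (T : ℝ) (x0 : Euc n)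
    (U : Set (Euc m)) (u : Ctrl m T) : Prop :=
  u ∈ admissible f T x0 ∧ u ∈ ctrlIn T U ∧
  (pontryaginCone f T x0 U u : Set (Euc n)) = univ

end ControlSystem

end

/-! Everything is read off two explicit formulas. Let `X` be a fundamental matrix of the linearized
equation along `x_u` and `Y` its inverse. By variation of constants the differential of the
end-point mapping is v ↦ X(T) ∫ Y(s) B(x_u(s),s) v(s) ds, and the needle (τ,ω) produces the vector
X(T) Y(τ) B(x_u(τ),τ) (ω - u(τ)). Since the system is affine in the control, a needle vector is the
integrand at τ for the variation ω - u.

Two comparisons follow. Averaging over [τ, τ+r] the variation that replaces `u` by ω, and letting r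
tend to 0 at a Lebesgue point, shows that needle vectors lie in the closure of the image of the
tangent cone (`strongVariationVectors_subset_closure`). Conversely, a linear form that is
nonpositive on needle vectors makes the integrand nonpositive at almost every time, first for ω in
U, then by linearity for ω in conv(U); so it is nonpositive on the image of the tangent cone of
conv(U) (`nonpos_on_image_ctrlTangentCone`).

In finite dimension a convex cone is the whole space as soon as no nonzero linear form is
nonpositive on it, with no closedness required (`exists_nonpos_of_cone_ne_univ`). The three
implications are therefore statements about linear forms. The converse of (ii) fails for x' = u with
U the half-line of nonnegative reals and u = 0: the integral is onto ℝ, but not on nonnegative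
controls.

The analytic work is the differentiability of the end-point mapping (`exists_hasFDerivAt_endpoint`).
The implicit function theorem applies to the integral state equation, whose partial differential in
the state is the identity minus a Volterra operator, hence invertible. A Gronwall argument
identifies the implicit function with the trajectory. -/

noncomputable section

/-! ### Vector-valued absolutely continuous functions -/

section AbsolutelyContinuous

variable {E F G : Type*} [NormedAddCommGroup E] [NormedSpace ℝ E]
  [NormedAddCommGroup F] [NormedSpace ℝ F] [NormedAddCommGroup G] [NormedSpace ℝ G]

open AbsolutelyContinuousOnInterval in
/-- A continuous bilinear map applied to two absolutely continuous functions is absolutely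
continuous. -/
theorem AbsolutelyContinuousOnInterval.bilinear (L : E →L[ℝ] F →L[ℝ] G) {f : ℝ → E} {g : ℝ → F}
    {a b : ℝ} (hf : AbsolutelyContinuousOnInterval f a b)
    (hg : AbsolutelyContinuousOnInterval g a b) :
    AbsolutelyContinuousOnInterval (fun t => L (f t) (g t)) a b := by
  obtain ⟨C, hC⟩ := hf.exists_bound
  obtain ⟨D, hD⟩ := hg.exists_bound
  unfold AbsolutelyContinuousOnInterval at hf hg
  apply squeeze_zero' ?_ ?_
    (by simpa using (hg.const_mul (‖L‖ * C)).add (hf.const_mul (‖L‖ * D)))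
  · exact Filter.Eventually.of_forall <| fun _ ↦ Finset.sum_nonneg (fun i hi ↦ dist_nonneg)
  rw [eventually_inf_principal]
  filter_upwards with (n, I) hnI
  simp only [Finset.mul_sum, ← Finset.sum_add_distrib]
  refine Finset.sum_le_sum fun i hi => ?_
  simp only [disjWithin, mem_ofPred_eq] at hnI
  have h1 := hC _ (hnI.1 i hi).1
  have h2 := hD _ (hnI.1 i hi).2
  simp only [dist_eq_norm]
  have : L (f (I i).1) (g (I i).1) - L (f (I i).2) (g (I i).2)
      = L (f (I i).1) (g (I i).1 - g (I i).2) + L (f (I i).1 - f (I i).2) (g (I i).2) := by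
    simp
  rw [this]
  refine (norm_add_le _ _).trans (add_le_add ?_ ?_)
  · refine (L.le_opNorm₂ _ _).trans ?_
    gcongr
  · refine (L.le_opNorm₂ _ _).trans ?_
    rw [mul_right_comm]
    gcongr

theorem AbsolutelyContinuousOnInterval.congr {X : Type*} [PseudoMetricSpace X] {f g : ℝ → X}
    {a b : ℝ} (hf : AbsolutelyContinuousOnInterval f a b) (h : EqOn f g (uIcc a b)) :
    AbsolutelyContinuousOnInterval g a b := by
  rw [absolutelyContinuousOnInterval_iff] at hf ⊢
  intro ε hε
  obtain ⟨δ, hδ, H⟩ := hf ε hε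
  refine ⟨δ, hδ, fun I hI hd => ?_⟩
  convert! H I hI hd using 1
  refine Finset.sum_congr rfl fun i hi => ?_
  rw [h (hI.1 i hi).1, h (hI.1 i hi).2]

theorem absolutelyContinuousOnInterval_const {X : Type*} [PseudoMetricSpace X] (c : X) (a b : ℝ) :
    AbsolutelyContinuousOnInterval (fun _ => c) a b := by
  simpa [AbsolutelyContinuousOnInterval] using tendsto_const_nhds

/-- Each increment is bounded by the increment of the primitive of ‖f‖, which reduces the claim to
real-valued integrands. -/
theorem IntervalIntegrable.absolutelyContinuousOnInterval_integral {f : ℝ → E} {a b c : ℝ}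
    (h : IntervalIntegrable f volume a b) (hc : c ∈ uIcc a b) :
    AbsolutelyContinuousOnInterval (fun x ↦ ∫ v in c..x, f v) a b := by
  have H := h.norm.absolutelyContinuousOnInterval_intervalIntegral hc
  rw [absolutelyContinuousOnInterval_iff] at H ⊢
  intro ε hε
  obtain ⟨δ, hδ, H⟩ := H ε hε
  refine ⟨δ, hδ, fun I hI hd => lt_of_le_of_lt (Finset.sum_le_sum fun i hi => ?_) (H I hI hd)⟩
  have hi1 := (hI.1 i hi).1
  have hi2 := (hI.1 i hi).2
  have sub : ∀ x ∈ uIcc a b, IntervalIntegrable f volume c x := fun x hx =>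
    h.mono_set (uIcc_subset_uIcc hc hx)
  rw [dist_eq_norm, dist_eq_norm, intervalIntegral.integral_interval_sub_left (sub _ hi1) (sub _ hi2),
    intervalIntegral.integral_interval_sub_left (sub _ hi1).norm (sub _ hi2).norm]
  exact intervalIntegral.norm_integral_le_abs_integral_norm

/-- Two absolutely continuous functions with the same derivative differ by a constant. -/
theorem AbsolutelyContinuousOnInterval.sub_eq_of_ae_hasDerivAt {f g f' : ℝ → E} {a b : ℝ}
    (hab : a ≤ b) (hf : AbsolutelyContinuousOnInterval f a b)
    (hg : AbsolutelyContinuousOnInterval g a b)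
    (hf' : ∀ᵐ t ∂(volume.restrict (Icc a b)), HasDerivAt f (f' t) t)
    (hg' : ∀ᵐ t ∂(volume.restrict (Icc a b)), HasDerivAt g (f' t) t) {t : ℝ} (ht : t ∈ Icc a b) :
    f t - g t = f a - g a := by
  obtain ⟨C, hC⟩ := (hf.sub hg).const_of_ae_hasDerivAt_zero (by
    rw [uIcc_of_le hab]
    rw [ae_restrict_iff' measurableSet_Icc] at hf' hg'
    filter_upwards [hf', hg'] with t h1 h2 ht
    simpa using (h1 ht).sub (h2 ht))
  rw [uIcc_of_le hab] at hC
  exact (hC t ht).trans (hC a (left_mem_Icc.2 hab)).symm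

theorem IntervalIntegrable.ae_hasDerivAt_integral_Icc [CompleteSpace E] {h : ℝ → E} {a b : ℝ}
    (hab : a ≤ b) (hh : IntervalIntegrable h volume a b) :
    ∀ᵐ t ∂(volume.restrict (Icc a b)), HasDerivAt (fun x => ∫ s in a..x, h s) (h t) t := by
  rw [ae_restrict_iff' measurableSet_Icc]
  filter_upwards [hh.ae_hasDerivAt_integral] with t ht h1
  rw [uIcc_of_le hab] at ht
  exact ht h1 a (left_mem_Icc.2 hab)

theorem AbsolutelyContinuousOnInterval.eq_add_integral [CompleteSpace E] {f h : ℝ → E} {a b : ℝ}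
    (hab : a ≤ b) (hf : AbsolutelyContinuousOnInterval f a b)
    (hh : IntervalIntegrable h volume a b)
    (hf' : ∀ᵐ t ∂(volume.restrict (Icc a b)), HasDerivAt f (h t) t) {t : ℝ} (ht : t ∈ Icc a b) :
    f t = f a + ∫ s in a..t, h s := by
  have := hf.sub_eq_of_ae_hasDerivAt hab (hh.absolutelyContinuousOnInterval_integral left_mem_uIcc)
    hf' (hh.ae_hasDerivAt_integral_Icc hab) ht
  simp only [intervalIntegral.integral_same, sub_zero] at this
  rw [← this]; abel

/-- If `f` agrees on `[a,b]` with `g`, it has the same derivatives as `g` almost everywhere on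
`[a,b]`. -/
theorem Set.EqOn.ae_hasDerivAt_Icc {f g f' : ℝ → E} {a b : ℝ} (h : EqOn f g (Icc a b))
    (hg : ∀ᵐ t ∂(volume.restrict (Icc a b)), HasDerivAt g (f' t) t) :
    ∀ᵐ t ∂(volume.restrict (Icc a b)), HasDerivAt f (f' t) t := by
  rw [← restrict_Ioo_eq_restrict_Icc] at hg ⊢
  filter_upwards [hg, ae_restrict_mem measurableSet_Ioo] with t ht htm
  refine ht.congr_of_eventuallyEq ?_
  filter_upwards [Ioo_mem_nhds htm.1 htm.2] with s hs using h (Ioo_subset_Icc_self hs)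

end AbsolutelyContinuous

namespace ControlSystem

/-! ### Volterra operators and linear equations with bounded measurable coefficients -/

section Volterra

set_option linter.unusedSectionVars false

variable {E F G : Type*} [NormedAddCommGroup E] [NormedSpace ℝ E] [CompleteSpace E]
  [NormedAddCommGroup F] [NormedSpace ℝ F] [NormedAddCommGroup G] [NormedSpace ℝ G] {T : ℝ}

theorem ae_norm_le_Lp_top (v : Lp G ∞ ((volume : Measure ℝ).restrict (Icc 0 T))) :
    ∀ᵐ s ∂(volume.restrict (Icc 0 T)), ‖v s‖ ≤ ‖v‖ := by
  have h := ae_le_eLpNormEssSup (f := v) (μ := volume.restrict (Icc 0 T))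
  filter_upwards [h] with s hs
  rw [Lp.norm_def, eLpNorm_exponent_top]
  have hfin : eLpNormEssSup v (volume.restrict (Icc 0 T)) ≠ ∞ := by
    have := Lp.eLpNorm_ne_top v
    rwa [eLpNorm_exponent_top] at this
  have := ENNReal.toReal_mono hfin hs
  simpa using this

theorem ae_norm_bilinear_le (hT : 0 ≤ T) (P : F →L[ℝ] G →L[ℝ] E) (b : C(Icc 0 T, F))
    (v : Lp G ∞ ((volume : Measure ℝ).restrict (Icc 0 T))) :
    ∀ᵐ s ∂(volume.restrict (Icc 0 T)), ‖P (IccExtend hT b s) (v s)‖ ≤ ‖P‖ * ‖b‖ * ‖v‖ := by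
  filter_upwards [ae_norm_le_Lp_top v] with s hs
  refine (P.le_opNorm₂ _ _).trans ?_
  gcongr
  exact b.norm_coe_le_norm _

theorem integrableOn_bilinear (hT : 0 ≤ T) (P : F →L[ℝ] G →L[ℝ] E) (b : C(Icc 0 T, F))
    (v : Lp G ∞ ((volume : Measure ℝ).restrict (Icc 0 T))) :
    IntegrableOn (fun s => P (IccExtend hT b s) (v s)) (Icc 0 T) := by
  refine Integrable.of_bound ?_ _ (ae_norm_bilinear_le hT P b v)
  have hb : Continuous (IccExtend hT b) := b.continuous.Icc_extend'
  exact P.aestronglyMeasurable_comp₂ (f := IccExtend hT b) (g := v) hb.aestronglyMeasurable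
    (Lp.aestronglyMeasurable v)

theorem intervalIntegrable_bilinear (hT : 0 ≤ T) (P : F →L[ℝ] G →L[ℝ] E) (b : C(Icc 0 T, F))
    (v : Lp G ∞ ((volume : Measure ℝ).restrict (Icc 0 T))) {r t : ℝ} (hr : r ∈ Icc 0 T)
    (ht : t ∈ Icc 0 T) :
    IntervalIntegrable (fun s => P (IccExtend hT b s) (v s)) volume r t := by
  rw [intervalIntegrable_iff]
  exact (integrableOn_bilinear hT P b v).mono_set
    (uIoc_subset_uIcc.trans (uIcc_subset_Icc hr ht))

theorem ae_Ioc_of_ae_Icc {p : ℝ → Prop} (h : ∀ᵐ s ∂(volume.restrict (Icc 0 T)), p s) {r t : ℝ}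
    (hr : r ∈ Icc 0 T) (ht : t ∈ Icc 0 T) : ∀ᵐ s, s ∈ uIoc r t → p s := by
  rw [ae_restrict_iff' measurableSet_Icc] at h
  filter_upwards [h] with s hs hs' using hs (uIcc_subset_Icc hr ht (uIoc_subset_uIcc hs'))

theorem norm_integral_bilinear_le (hT : 0 ≤ T) (P : F →L[ℝ] G →L[ℝ] E) (b : C(Icc 0 T, F))
    (v : Lp G ∞ ((volume : Measure ℝ).restrict (Icc 0 T))) {t : ℝ} (ht : t ∈ Icc 0 T) :
    ‖∫ s in 0..t, P (IccExtend hT b s) (v s)‖ ≤ ‖P‖ * T * ‖b‖ * ‖v‖ := by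
  have h := intervalIntegral.norm_integral_le_of_norm_le_const_ae
    (ae_Ioc_of_ae_Icc (ae_norm_bilinear_le hT P b v) (left_mem_Icc.2 hT) ht)
  refine h.trans ?_
  rw [sub_zero, abs_of_nonneg ht.1]
  calc _ ≤ ‖P‖ * ‖b‖ * ‖v‖ * T := by gcongr; exact ht.2
    _ = _ := by ring

theorem continuous_integral_bilinear (hT : 0 ≤ T) (P : F →L[ℝ] G →L[ℝ] E) (b : C(Icc 0 T, F))
    (v : Lp G ∞ ((volume : Measure ℝ).restrict (Icc 0 T))) :
    Continuous fun t : Icc 0 T => ∫ s in (0 : ℝ)..t, P (IccExtend hT b s) (v s) := by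
  have := ((intervalIntegrable_bilinear hT P b v (left_mem_Icc.2 hT)
    (right_mem_Icc.2 hT)).absolutelyContinuousOnInterval_integral left_mem_uIcc).continuousOn
  rw [uIcc_of_le hT] at this
  exact continuousOn_iff_continuous_domRestrict.1 this

/-- The bilinear Volterra operator `(b,v) ↦ (t ↦ ∫₀ᵗ P(b(s), v(s)) ds)`. -/
def volterra (hT : 0 ≤ T) (P : F →L[ℝ] G →L[ℝ] E) :
    C(Icc 0 T, F) →L[ℝ] Lp G ∞ ((volume : Measure ℝ).restrict (Icc 0 T)) →L[ℝ] C(Icc 0 T, E) :=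
  LinearMap.mkContinuous₂
    (LinearMap.mk₂ ℝ
      (fun b v => ⟨fun t => ∫ s in (0 : ℝ)..t, P (IccExtend hT b s) (v s),
        continuous_integral_bilinear hT P b v⟩)
      (fun b b' v => by
        ext t
        simp only [ContinuousMap.coe_mk, ContinuousMap.add_apply]
        rw [← intervalIntegral.integral_add
          (intervalIntegrable_bilinear hT P b v (left_mem_Icc.2 hT) t.2)
          (intervalIntegrable_bilinear hT P b' v (left_mem_Icc.2 hT) t.2)]
        simp [IccExtend])
      (fun c b v => by
        ext t
        simp only [ContinuousMap.coe_mk, ContinuousMap.smul_apply]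
        rw [← intervalIntegral.integral_smul]
        simp [IccExtend])
      (fun b v v' => by
        ext t
        simp only [ContinuousMap.coe_mk, ContinuousMap.add_apply]
        rw [← intervalIntegral.integral_add
          (intervalIntegrable_bilinear hT P b v (left_mem_Icc.2 hT) t.2)
          (intervalIntegrable_bilinear hT P b v' (left_mem_Icc.2 hT) t.2)]
        refine intervalIntegral.integral_congr_ae
          (ae_Ioc_of_ae_Icc ?_ (left_mem_Icc.2 hT) t.2)
        filter_upwards [Lp.coeFn_add v v'] with s hs
        simp only [hs, Pi.add_apply, map_add])
      (fun c b v => by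
        ext t
        simp only [ContinuousMap.coe_mk, ContinuousMap.smul_apply]
        rw [← intervalIntegral.integral_smul]
        refine intervalIntegral.integral_congr_ae
          (ae_Ioc_of_ae_Icc ?_ (left_mem_Icc.2 hT) t.2)
        filter_upwards [Lp.coeFn_smul c v] with s hs
        simp only [hs, Pi.smul_apply, map_smul]))
    (‖P‖ * T)
    (fun b v => (ContinuousMap.norm_le _ (by positivity)).2 fun t =>
      norm_integral_bilinear_le hT P b v t.2)

theorem volterra_apply (hT : 0 ≤ T) (P : F →L[ℝ] G →L[ℝ] E) (b : C(Icc 0 T, F))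
    (v : Lp G ∞ ((volume : Measure ℝ).restrict (Icc 0 T))) (t : Icc 0 T) :
    volterra hT P b v t = ∫ s in (0 : ℝ)..t, P (IccExtend hT b s) (v s) := rfl

/-- The operator `ξ ↦ (t ↦ ∫₀ᵗ P(ξ(s), a(s)) ds)`. -/
def volterraEnd (hT : 0 ≤ T) (P : E →L[ℝ] G →L[ℝ] E)
    (a : Lp G ∞ ((volume : Measure ℝ).restrict (Icc 0 T))) :
    C(Icc 0 T, E) →L[ℝ] C(Icc 0 T, E) :=
  (volterra hT P).flip a

/-- Each further iteration integrates a multiple of s^k over [0,t], which supplies the factor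
1/(k+1) and, in the end, the factorial. -/
theorem norm_volterraEnd_pow_apply_le (hT : 0 ≤ T) (P : E →L[ℝ] G →L[ℝ] E)
    (a : Lp G ∞ ((volume : Measure ℝ).restrict (Icc 0 T))) (k : ℕ) (ξ : C(Icc 0 T, E))
    (t : Icc (0 : ℝ) T) :
    ‖(volterraEnd hT P a ^ k) ξ t‖ ≤ (‖P‖ * ‖a‖ * t) ^ k / k.factorial * ‖ξ‖ := by
  induction k generalizing t with
  | zero => simpa using ξ.norm_coe_le_norm t
  | succ k ih =>
    rw [pow_succ', mul_apply_eq_comp]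
    set η := (volterraEnd hT P a ^ k) ξ
    set M := ‖P‖ * ‖a‖
    change ‖∫ s in (0 : ℝ)..t, P (IccExtend hT η s) (a s)‖ ≤ _
    have hb : ∀ᵐ s, s ∈ Ioc (0 : ℝ) t →
        ‖P (IccExtend hT η s) (a s)‖ ≤ M * ((M * s) ^ k / k.factorial * ‖ξ‖) := by
      have := ae_Ioc_of_ae_Icc (ae_norm_le_Lp_top a) (left_mem_Icc.2 hT) t.2
      rw [uIoc_of_le t.2.1] at this
      filter_upwards [this] with s hs hst
      have hsT : s ∈ Icc 0 T := ⟨hst.1.le, hst.2.trans t.2.2⟩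
      refine (P.le_opNorm₂ _ _).trans ?_
      rw [IccExtend_of_mem _ _ hsT]
      calc _ ≤ ‖P‖ * ((M * s) ^ k / k.factorial * ‖ξ‖) * ‖a‖ := by
            have h1 := ih ⟨s, hsT⟩
            have h2 := hs hst
            have : 0 ≤ (M * s) ^ k / k.factorial * ‖ξ‖ := (norm_nonneg _).trans h1
            gcongr
        _ = _ := by ring
    refine (intervalIntegral.norm_integral_le_of_norm_le t.2.1 hb
      (Continuous.intervalIntegrable (by fun_prop) _ _)).trans (le_of_eq ?_)
    have : ∀ s : ℝ, M * ((M * s) ^ k / k.factorial * ‖ξ‖)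
        = (M ^ (k + 1) / k.factorial * ‖ξ‖) * s ^ k := fun s => by ring
    simp_rw [this]
    rw [intervalIntegral.integral_const_mul, integral_pow]
    rw [Nat.factorial_succ]
    push_cast
    field_simp
    simp [mul_pow, mul_comm, mul_left_comm]

/-- The operator need not have norm below 1 when T is large, but by the factorial bound some power
V^k does. Then 1 - V^k is invertible, and 1 - V is one of its commuting factors. -/
theorem isUnit_one_sub_volterraEnd (hT : 0 ≤ T) (P : E →L[ℝ] G →L[ℝ] E)
    (a : Lp G ∞ ((volume : Measure ℝ).restrict (Icc 0 T))) :
    IsUnit (1 - volterraEnd hT P a) := by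
  set V := volterraEnd hT P a
  obtain ⟨k, hk⟩ := ((FloorSemiring.tendsto_pow_div_factorial_atTop
    (‖P‖ * ‖a‖ * T)).eventually_lt_const one_pos).exists
  have hV : ‖V ^ k‖ < 1 := by
    refine lt_of_le_of_lt (ContinuousLinearMap.opNorm_le_bound _ (by positivity) fun ξ => ?_) hk
    refine (ContinuousMap.norm_le _ (by positivity)).2 fun t => ?_
    refine (norm_volterraEnd_pow_apply_le hT P a k ξ t).trans ?_
    have := t.2.1
    have := t.2.2
    gcongr
  have h1 : IsUnit (1 - V ^ k) := by
    simpa using (Units.oneSub (V ^ k) hV).isUnit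
  have hc : Commute (1 - V) (∑ i ∈ Finset.range k, V ^ i) :=
    ((Commute.one_left _).sub_left
      (Commute.sum_right _ _ _ fun i _ => (Commute.refl V).pow_right i))
  rw [← mul_neg_geom_sum, hc.isUnit_mul_iff] at h1
  exact h1.1

/-- A solution is the preimage of the constant z under the invertible operator 1 - V. -/
theorem exists_eq_add_integral (hT : 0 ≤ T) (P : E →L[ℝ] G →L[ℝ] E)
    (a : Lp G ∞ ((volume : Measure ℝ).restrict (Icc 0 T))) (z : E) :
    ∃ x : ℝ → E, AbsolutelyContinuousOnInterval x 0 T ∧ x 0 = z ∧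
      ∀ᵐ t ∂(volume.restrict (Icc 0 T)), HasDerivAt x (P (x t) (a t)) t := by
  obtain ⟨R, hR⟩ := (isUnit_one_sub_volterraEnd hT P a).exists_right_inv
  set ξ := R (ContinuousMap.const _ z)
  have hξ : ∀ t : Icc 0 T, ξ t - ∫ s in (0 : ℝ)..t, P (IccExtend hT ξ s) (a s) = z := fun t =>
    congr($hR (ContinuousMap.const _ z) t)
  have hint := intervalIntegrable_bilinear hT P ξ a (left_mem_Icc.2 hT) (right_mem_Icc.2 hT)
  have heq : EqOn (IccExtend hT ξ) (fun t => z + ∫ s in (0 : ℝ)..t, P (IccExtend hT ξ s) (a s))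
      (Icc 0 T) := fun t ht => by
    rw [IccExtend_of_mem _ _ ht, ← hξ ⟨t, ht⟩]
    simp
  refine ⟨IccExtend hT ξ, ?_, ?_, ?_⟩
  · refine AbsolutelyContinuousOnInterval.congr (((absolutelyContinuousOnInterval_const z 0 T).add
      (hint.absolutelyContinuousOnInterval_integral left_mem_uIcc))) ?_
    rw [uIcc_of_le hT]
    exact heq.symm
  · simpa using heq (left_mem_Icc.2 hT)
  · refine heq.ae_hasDerivAt_Icc ?_
    filter_upwards [hint.ae_hasDerivAt_integral_Icc hT] with t ht using ht.const_add z

end Volterra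

/-! ### Fundamental matrix and its inverse -/

section Fundamental

variable {E : Type*} [NormedAddCommGroup E] [NormedSpace ℝ E] [FiniteDimensional ℝ E] {T : ℝ}

/-- The fundamental matrix of a linear equation with bounded measurable coefficients, and its
inverse. -/
theorem exists_fundamental (hT : 0 ≤ T)
    (a : Lp (E →L[ℝ] E) ∞ ((volume : Measure ℝ).restrict (Icc 0 T))) :
    ∃ X Y : ℝ → E →L[ℝ] E, AbsolutelyContinuousOnInterval X 0 T ∧
      AbsolutelyContinuousOnInterval Y 0 T ∧
      (∀ᵐ t ∂(volume.restrict (Icc 0 T)), HasDerivAt X (a t ∘L X t) t) ∧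
      (∀ᵐ t ∂(volume.restrict (Icc 0 T)), HasDerivAt Y (-(Y t ∘L a t)) t) ∧
      ∀ t ∈ Icc 0 T, X t ∘L Y t = 1 := by
  have := FiniteDimensional.complete ℝ E
  obtain ⟨X, hX, hX0, hX'⟩ := exists_eq_add_integral hT
    (ContinuousLinearMap.compL ℝ E E E).flip a 1
  obtain ⟨Y, hY, hY0, hY'⟩ := exists_eq_add_integral hT
    (-(ContinuousLinearMap.compL ℝ E E E)) a 1
  have hX'' : ∀ᵐ t ∂(volume.restrict (Icc 0 T)), HasDerivAt X (a t ∘L X t) t := hX'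
  have hY'' : ∀ᵐ t ∂(volume.restrict (Icc 0 T)), HasDerivAt Y (-(Y t ∘L a t)) t := hY'
  -- The product Y X has derivative -Y a X + Y a X = 0. The product X Y has derivative a X Y - X Y
  -- a, which is not visibly zero, so that order is recovered below: in finite dimension a one-sided
  -- inverse is two-sided.
  have hYX : ∀ t ∈ Icc 0 T, Y t ∘L X t = 1 := fun t ht => by
    have := (hY.bilinear (ContinuousLinearMap.compL ℝ E E E) hX).sub_eq_of_ae_hasDerivAt
      (g := fun _ => 1) (f' := fun _ => 0) hT (absolutelyContinuousOnInterval_const _ _ _) (by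
        filter_upwards [hX'', hY''] with t h1 h2
        have := (ContinuousLinearMap.compL ℝ E E E).hasFDerivAt_of_bilinear h2.hasFDerivAt
          h1.hasFDerivAt
        convert! this.hasDerivAt using 1
        ext z
        simp) (ae_of_all _ fun t => hasDerivAt_const _ _) ht
    simp only [ContinuousLinearMap.compL_apply, hX0, hY0] at this
    rw [← sub_eq_zero, this]
    ext z; simp
  refine ⟨X, Y, hX, hY, hX'', hY'', fun t ht => ?_⟩
  have h := hYX t ht
  have h2 : (Y t : E →ₗ[ℝ] E) * (X t : E →ₗ[ℝ] E) = 1 := by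
    ext z; exact congr($h z)
  have h3 := mul_eq_one_comm.1 h2
  ext z; exact congr($h3 z)

end Fundamental

/-! ### Differentiability of superposition operators -/

section Nemytskii

set_option linter.unusedSectionVars false

variable {E F : Type*} [NormedAddCommGroup E] [NormedSpace ℝ E]
  [NormedAddCommGroup F] [NormedSpace ℝ F] {T : ℝ}

theorem continuous_restrict_Icc {X : Type*} [TopologicalSpace X] {φ : E → ℝ → X}
    (hφ : ContinuousOn (fun q : E × ℝ => φ q.1 q.2) (univ ×ˢ Icc 0 T)) :
    Continuous fun q : E × Icc (0 : ℝ) T => φ q.1 q.2 :=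
  hφ.comp_continuous (f := fun q : E × Icc (0 : ℝ) T => (q.1, (q.2 : ℝ))) (by fun_prop)
    fun q => ⟨mem_univ _, q.2.2⟩

/-- The superposition (Nemytskii) operator `x ↦ (t ↦ φ(x(t), t))`. -/
def superposition (φ : E → ℝ → F)
    (hφ : ContinuousOn (fun q : E × ℝ => φ q.1 q.2) (univ ×ˢ Icc 0 T)) (x : C(Icc 0 T, E)) :
    C(Icc 0 T, F) :=
  ⟨fun t => φ (x t) t, (continuous_restrict_Icc hφ).comp (x.continuous.prodMk continuous_id)⟩

/-- The linear operator `ξ ↦ (t ↦ A(t) ξ(t))`. -/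
def pointwiseApply (A : C(Icc 0 T, E →L[ℝ] F)) : C(Icc 0 T, E) →L[ℝ] C(Icc 0 T, F) :=
  LinearMap.mkContinuous
    { toFun := fun ξ => ⟨fun t => A t (ξ t), A.continuous.clm_apply ξ.continuous⟩
      map_add' := fun ξ η => by ext t; simp
      map_smul' := fun c ξ => by ext t; simp } ‖A‖
    fun ξ => (ContinuousMap.norm_le _ (mul_nonneg (norm_nonneg A) (norm_nonneg ξ))).2 fun t =>
      ((A t).le_opNorm _).trans (by
        gcongr
        exacts [A.norm_coe_le_norm t, ξ.norm_coe_le_norm t])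

theorem pointwiseApply_apply (A : C(Icc 0 T, E →L[ℝ] F)) (ξ : C(Icc 0 T, E)) (t : Icc 0 T) :
    pointwiseApply A ξ t = A t (ξ t) := rfl

/-- The partial differential is uniformly close to its values along the graph of `x`, by compactness
of [0,T]; the mean value inequality at each t then gives an estimate uniform in t. -/
theorem hasStrictFDerivAt_superposition {φ : E → ℝ → F} (hφ : IsC1InFst T φ)
    (x : C(Icc 0 T, E)) :
    HasStrictFDerivAt (superposition φ hφ.1)
      (pointwiseApply (superposition (fun y t => fderiv ℝ (fun y => φ y t) y) hφ.2.2 x)) x := by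
  rw [hasStrictFDerivAt_iff_isLittleO, Asymptotics.isLittleO_iff]
  intro ε hε
  set D : E → ℝ → E →L[ℝ] F := fun y t => fderiv ℝ (fun y => φ y t) y
  -- Currying turns joint continuity into continuity at 0 of y ↦ (t ↦ D(x(t) + y, t)) for the
  -- uniform norm, which yields a δ independent of t.
  let Dx : C(E × Icc 0 T, E →L[ℝ] F) := ⟨fun q => D (x q.2 + q.1) q.2,
    (continuous_restrict_Icc (φ := D) hφ.2.2).comp (by fun_prop :
      Continuous fun q : E × Icc 0 T => (x q.2 + q.1, q.2))⟩
  obtain ⟨δ, hδ, hD⟩ := Metric.continuousAt_iff (β := C(Icc 0 T, E →L[ℝ] F)).1 (Dx.curry.continuous.continuousAt (x := 0)) ε hε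
  have hbound : ∀ (t : Icc 0 T), ∀ y ∈ Metric.ball (x t) δ, ‖D y t - D (x t) t‖ ≤ ε := by
    intro t y hy
    have h := (hD (x := y - x t) (by simpa [dist_eq_norm] using hy)).le
    have := (ContinuousMap.dist_apply_le_dist t).trans h
    simpa [Dx, dist_eq_norm] using this
  filter_upwards [Metric.ball_mem_nhds (x, x) hδ] with p hp
  rw [← ball_prod_same] at hp
  refine (ContinuousMap.norm_le _ (by positivity)).2 fun t => ?_
  have hmem : ∀ y ∈ Metric.ball x δ, y t ∈ Metric.ball (x t) δ := fun y hy =>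
    (ContinuousMap.dist_apply_le_dist t).trans_lt hy
  refine ((convex_ball (x t) δ).norm_image_sub_le_of_norm_fderiv_le'
    (fun y _ => hφ.2.1 t t.2 y) (hbound t) (hmem _ hp.2) (hmem _ hp.1)).trans ?_
  gcongr
  exact (p.1 - p.2).norm_coe_le_norm t

end Nemytskii

/-! ### The state equation and its implicit solution -/

section StateMap

set_option linter.unusedSectionVars false

variable {E M : Type*} [NormedAddCommGroup E] [NormedSpace ℝ E] [CompleteSpace E]
  [NormedAddCommGroup M] [NormedSpace ℝ M] [CompleteSpace M] {T : ℝ}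
  {g : E → ℝ → E} {B : E → ℝ → (M →L[ℝ] E)}

/-- The map `(v, ξ) ↦ (t ↦ ξ(t) - x₀ - ∫₀ᵗ (g(ξ,s) + B(ξ,s) v) ds)`, whose zeros are the pairs of
a control and an associated trajectory. -/
def stateMap (hT : 0 ≤ T) (hg : IsC1InFst T g) (hB : IsC1InFst T B) (x0 : E)
    (p : Lp M ∞ ((volume : Measure ℝ).restrict (Icc 0 T)) × C(Icc 0 T, E)) : C(Icc 0 T, E) :=
  p.2 - ContinuousMap.const _ x0
    -- The drift goes through the same bilinear operator, paired with the constant control 1.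
    - volterra hT (ContinuousLinearMap.lsmul ℝ ℝ).flip (superposition g hg.1 p.2)
      (Lp.const ∞ _ (1 : ℝ))
    - volterra hT (ContinuousLinearMap.id ℝ (M →L[ℝ] E)) (superposition B hB.1 p.2) p.1

theorem intervalIntegrable_velocity (hT : 0 ≤ T) (hg : IsC1InFst T g) (hB : IsC1InFst T B)
    (v : Lp M ∞ ((volume : Measure ℝ).restrict (Icc 0 T))) (ξ : C(Icc 0 T, E)) :
    IntervalIntegrable
      (fun s => g (IccExtend hT ξ s) s + B (IccExtend hT ξ s) s (v s)) volume 0 T := by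
  have h1 : IntervalIntegrable (IccExtend hT (superposition g hg.1 ξ)) volume 0 T :=
    (superposition g hg.1 ξ).continuous.Icc_extend'.intervalIntegrable _ _
  have h2 := intervalIntegrable_bilinear hT (ContinuousLinearMap.id ℝ (M →L[ℝ] E))
    (superposition B hB.1 ξ) v (left_mem_Icc.2 hT) (right_mem_Icc.2 hT)
  refine (h1.add h2).congr fun s hs => ?_
  have hs' : s ∈ Icc 0 T := by
    rw [uIoc_of_le hT] at hs; exact Ioc_subset_Icc_self hs
  simp [IccExtend_of_mem _ _ hs', superposition]

theorem stateMap_apply (hT : 0 ≤ T) (hg : IsC1InFst T g) (hB : IsC1InFst T B) (x0 : E)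
    (v : Lp M ∞ ((volume : Measure ℝ).restrict (Icc 0 T))) (ξ : C(Icc 0 T, E)) (t : Icc 0 T) :
    stateMap hT hg hB x0 (v, ξ) t =
      ξ t - x0 - ∫ s in (0 : ℝ)..t, (g (IccExtend hT ξ s) s + B (IccExtend hT ξ s) s (v s)) := by
  simp only [stateMap, ContinuousMap.sub_apply, volterra_apply, ContinuousMap.const_apply]
  rw [sub_sub (_ - _), ← intervalIntegral.integral_add
    (intervalIntegrable_bilinear hT _ _ _ (left_mem_Icc.2 hT) t.2)
    (intervalIntegrable_bilinear hT _ _ _ (left_mem_Icc.2 hT) t.2)]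
  congr 1
  refine intervalIntegral.integral_congr_ae (ae_Ioc_of_ae_Icc ?_ (left_mem_Icc.2 hT) t.2)
  filter_upwards [Lp.coeFn_const ∞ (volume.restrict (Icc 0 T)) (1 : ℝ),
    ae_restrict_mem measurableSet_Icc] with s hs hs'
  rw [hs]
  simp [IccExtend_of_mem _ _ hs', superposition]

/-- Gives the coefficient of the linearized equation as an element of L^∞. With `Q` the evaluation
at the control value, the second term is the x-differential of B(x,s) u(s). -/
theorem memLp_linearization {W : Type*} [NormedAddCommGroup W] [NormedSpace ℝ W] (hT : 0 ≤ T)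
    (Ag : C(Icc 0 T, E →L[ℝ] E)) (AB : C(Icc 0 T, E →L[ℝ] W)) (Q : M →L[ℝ] W →L[ℝ] E)
    (u : Lp M ∞ ((volume : Measure ℝ).restrict (Icc 0 T))) :
    MemLp (fun s => IccExtend hT Ag s + Q (u s) ∘L IccExtend hT AB s) ∞
      (volume.restrict (Icc 0 T)) := by
  have hAg : Continuous (IccExtend hT Ag) := Ag.continuous.Icc_extend'
  have hAB : Continuous (IccExtend hT AB) := AB.continuous.Icc_extend'
  have hm := (isBoundedBilinearMap_comp (𝕜 := ℝ) (E := E) (F := W)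
    (G := E)).continuous.comp_aestronglyMeasurable
    ((Q.continuous.comp_aestronglyMeasurable (Lp.aestronglyMeasurable u)).prodMk
      hAB.aestronglyMeasurable)
  refine memLp_top_of_bound (C := ‖Ag‖ + ‖Q‖ * ‖u‖ * ‖AB‖) (hAg.aestronglyMeasurable.add hm) ?_
  filter_upwards [ae_norm_le_Lp_top u] with s hs
  refine (norm_add_le _ _).trans (add_le_add (Ag.norm_coe_le_norm _) ?_)
  refine (ContinuousLinearMap.opNorm_comp_le _ _).trans ?_
  have h1 : ‖Q (u s)‖ ≤ ‖Q‖ * ‖u‖ := (Q.le_opNorm _).trans (by gcongr)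
  have h2 : ‖IccExtend hT AB s‖ ≤ ‖AB‖ := AB.norm_coe_le_norm _
  gcongr

/-- The control enters only through a bounded bilinear operator applied to B(ξ,·) and v, so the
superposition result and the product rule suffice. The two x-derivative terms merge into one
Volterra operator with coefficient `a`. -/
theorem hasStrictFDerivAt_stateMap (hT : 0 ≤ T) (hg : IsC1InFst T g) (hB : IsC1InFst T B) (x0 : E)
    (u : Lp M ∞ ((volume : Measure ℝ).restrict (Icc 0 T))) (ξ : C(Icc 0 T, E)) :
    ∃ (D : Lp M ∞ ((volume : Measure ℝ).restrict (Icc 0 T)) × C(Icc 0 T, E) →L[ℝ] C(Icc 0 T, E))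
      (a : Lp (E →L[ℝ] E) ∞ ((volume : Measure ℝ).restrict (Icc 0 T))),
      HasStrictFDerivAt (stateMap hT hg hB x0) D (u, ξ) ∧
      (∀ᵐ s ∂(volume.restrict (Icc 0 T)),
        HasFDerivAt (fun y => g y s + B y s (u s)) (a s) (IccExtend hT ξ s)) ∧
      ∀ v η, D (v, η) = η
        - volterraEnd hT (ContinuousLinearMap.id ℝ (E →L[ℝ] E)).flip a η
        - volterra hT (ContinuousLinearMap.id ℝ (M →L[ℝ] E)) (superposition B hB.1 ξ) v := by
  set Ag := superposition (fun y t => fderiv ℝ (fun y => g y t) y) hg.2.2 ξ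
  set AB := superposition (fun y t => fderiv ℝ (fun y => B y t) y) hB.2.2 ξ
  have hmem := memLp_linearization hT Ag AB (ContinuousLinearMap.id ℝ (M →L[ℝ] E)).flip u
  have h1 : HasStrictFDerivAt (fun p : Lp M ∞ ((volume : Measure ℝ).restrict (Icc 0 T)) ×
      C(Icc 0 T, E) => superposition g hg.1 p.2) _ (u, ξ) :=
    (hasStrictFDerivAt_superposition hg ξ).comp (u, ξ) hasStrictFDerivAt_snd
  have h2 : HasStrictFDerivAt (fun p : Lp M ∞ ((volume : Measure ℝ).restrict (Icc 0 T)) ×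
      C(Icc 0 T, E) => superposition B hB.1 p.2) _ (u, ξ) :=
    (hasStrictFDerivAt_superposition hB ξ).comp (u, ξ) hasStrictFDerivAt_snd
  have h3 := (((volterra hT (ContinuousLinearMap.lsmul ℝ ℝ).flip).flip
    (Lp.const ∞ _ (1 : ℝ))).hasStrictFDerivAt (x := superposition g hg.1 ξ)).comp (u, ξ) h1
  have h4 := (volterra hT (ContinuousLinearMap.id ℝ (M →L[ℝ] E))).hasStrictFDerivAt_of_bilinear
    h2 (hasStrictFDerivAt_fst (p := (u, ξ)))
  have hD := ((hasStrictFDerivAt_snd.sub_const (ContinuousMap.const (Icc 0 T) x0)).sub h3).sub h4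
  refine ⟨_, hmem.toLp _, hD, ?_, ?_⟩
  · filter_upwards [hmem.coeFn_toLp, ae_restrict_mem measurableSet_Icc] with s hs hs'
    rw [hs, IccExtend_of_mem _ _ hs', IccExtend_of_mem _ _ hs', IccExtend_of_mem _ _ hs']
    have e1 := (hg.2.1 s hs' (ξ ⟨s, hs'⟩)).hasFDerivAt
    have e2 := (hB.2.1 s hs' (ξ ⟨s, hs'⟩)).hasFDerivAt
    convert! e1.add (e2.clm_apply (hasFDerivAt_const (u s) _)) using 1
    ext z
    simp [Ag, AB, superposition]
  · intro v η
    ext t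
    have key : volterraEnd hT (ContinuousLinearMap.id ℝ (E →L[ℝ] E)).flip (hmem.toLp _) η t =
        volterra hT (ContinuousLinearMap.lsmul ℝ ℝ).flip (pointwiseApply Ag η)
          (Lp.const ∞ _ (1 : ℝ)) t +
        volterra hT (ContinuousLinearMap.id ℝ (M →L[ℝ] E)) (pointwiseApply AB η) u t := by
      change volterra hT _ η (hmem.toLp _) t = _
      rw [volterra_apply, volterra_apply, volterra_apply, ← intervalIntegral.integral_add
        (intervalIntegrable_bilinear hT _ _ _ (left_mem_Icc.2 hT) t.2)
        (intervalIntegrable_bilinear hT _ _ _ (left_mem_Icc.2 hT) t.2)]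
      refine intervalIntegral.integral_congr_ae (ae_Ioc_of_ae_Icc ?_ (left_mem_Icc.2 hT) t.2)
      filter_upwards [hmem.coeFn_toLp, Lp.coeFn_const ∞ (volume.restrict (Icc 0 T)) (1 : ℝ),
        ae_restrict_mem measurableSet_Icc] with s hs h1 hs'
      rw [hs, h1]
      simp [IccExtend_of_mem _ _ hs', pointwiseApply_apply]
    simp only [ContinuousMap.sub_apply, key]
    simp [Ag, AB]
    abel

/-- The linearization of the state equation is solvable with respect to the state. -/
theorem exists_hasFDerivAt_implicit (hT : 0 ≤ T) (hg : IsC1InFst T g) (hB : IsC1InFst T B) (x0 : E)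
    (u : Lp M ∞ ((volume : Measure ℝ).restrict (Icc 0 T))) (ξ : C(Icc 0 T, E))
    (h0 : stateMap hT hg hB x0 (u, ξ) = 0) :
    ∃ (ψ : Lp M ∞ ((volume : Measure ℝ).restrict (Icc 0 T)) → C(Icc 0 T, E))
      (D : Lp M ∞ ((volume : Measure ℝ).restrict (Icc 0 T)) →L[ℝ] C(Icc 0 T, E))
      (a : Lp (E →L[ℝ] E) ∞ ((volume : Measure ℝ).restrict (Icc 0 T))),
      HasFDerivAt ψ D u ∧ (∀ᶠ v in 𝓝 u, stateMap hT hg hB x0 (v, ψ v) = 0) ∧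
      (∀ᵐ s ∂(volume.restrict (Icc 0 T)),
        HasFDerivAt (fun y => g y s + B y s (u s)) (a s) (IccExtend hT ξ s)) ∧
      ∀ v (t : Icc 0 T), D v t = ∫ s in (0 : ℝ)..t, (a s (IccExtend hT (D v) s)
        + B (IccExtend hT ξ s) s (v s)) := by
  obtain ⟨Φ, a, hΦ, ha, hf⟩ := hasStrictFDerivAt_stateMap hT hg hB x0 u ξ
  set P := (ContinuousLinearMap.id ℝ (E →L[ℝ] E)).flip
  have hinr : Φ ∘L .inr ℝ _ _ = 1 - volterraEnd hT P a := by
    ext1 η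
    simp [hf]
  have hinv : (Φ ∘L .inr ℝ _ _).IsInvertible := by
    rw [hinr]
    obtain ⟨e, he⟩ := isUnit_one_sub_volterraEnd hT P a
    exact ⟨ContinuousLinearEquiv.unitsEquiv ℝ _ e, by rw [← he]; rfl⟩
  have hψ := (hΦ.hasStrictFDerivAt_implicitFunctionOfProdDomain hinv).hasFDerivAt
  refine ⟨_, _, a, hψ, ?_, ha, ?_⟩
  · simpa only [h0] using hΦ.eventually_apply_implicitFunctionOfProdDomain hinv
  · intro v t
    set D := (-(Φ ∘L .inr ℝ _ _).inverse ∘L (Φ ∘L .inl ℝ _ _))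
    -- The differential of the implicit function is -Φ_ξ⁻¹ Φ_v, so its graph lies in the kernel of
    -- Φ, which is the linearized state equation.
    have hz : Φ (v, D v) = 0 := by
      have h1 : Φ (v, D v) = (Φ ∘L .inl ℝ _ _) v + (Φ ∘L .inr ℝ _ _) (D v) := by
        simp [← map_add]
      rw [h1]
      have h2 : (Φ ∘L .inr ℝ _ _) (D v) = -((Φ ∘L .inl ℝ _ _) v) := by
        have := hinv.self_comp_inverse
        have := congr($this ((Φ ∘L .inl ℝ _ _) v))
        rw [ContinuousLinearMap.comp_apply] at this
        change (Φ ∘L .inr ℝ _ _) (-((Φ ∘L .inr ℝ _ _).inverse ((Φ ∘L .inl ℝ _ _) v))) = _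
        rw [map_neg, this]; rfl
      rw [h2, add_neg_cancel]
    rw [hf] at hz
    have h3 := congr($hz t)
    simp only [volterraEnd, ContinuousLinearMap.flip_apply, volterra_apply,
      ContinuousMap.sub_apply, ContinuousMap.zero_apply] at h3
    rw [sub_sub, ← intervalIntegral.integral_add
        (intervalIntegrable_bilinear hT _ _ _ (left_mem_Icc.2 hT) t.2)
        (intervalIntegrable_bilinear hT _ _ _ (left_mem_Icc.2 hT) t.2), sub_eq_zero] at h3
    rw [h3]
    refine intervalIntegral.integral_congr_ae (ae_Ioc_of_ae_Icc ?_ (left_mem_Icc.2 hT) t.2)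
    filter_upwards [ae_restrict_mem measurableSet_Icc] with s hs'
    simp [IccExtend_of_mem _ _ hs', superposition, P]

end StateMap

/-! ### Uniqueness of trajectories -/

section Uniqueness

variable {E F M : Type*} [NormedAddCommGroup E] [NormedSpace ℝ E] [FiniteDimensional ℝ E]
  [NormedAddCommGroup F] [NormedSpace ℝ F]
  [NormedAddCommGroup M] [NormedSpace ℝ M] [CompleteSpace M] {T : ℝ}
  {g : E → ℝ → E} {B : E → ℝ → (M →L[ℝ] E)}

theorem IsC1InFst.exists_lipschitz {φ : E → ℝ → F} (hφ : IsC1InFst T φ) (R : ℝ) :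
    ∃ L, 0 ≤ L ∧ ∀ t ∈ Icc 0 T, ∀ y ∈ Metric.closedBall (0 : E) R,
      ∀ z ∈ Metric.closedBall (0 : E) R, ‖φ z t - φ y t‖ ≤ L * ‖z - y‖ := by
  obtain ⟨L, hL⟩ := ((isCompact_closedBall (0 : E) R).prod
    (isCompact_Icc (a := (0 : ℝ)) (b := T))).exists_bound_of_continuousOn
    (hφ.2.2.mono (prod_mono (subset_univ _) Subset.rfl))
  refine ⟨max L 0, le_max_right _ _, fun t ht y hy z hz => ?_⟩
  exact (convex_closedBall (0 : E) R).norm_image_sub_le_of_norm_fderiv_le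
    (fun w _ => hφ.2.1 t ht w) (fun w hw => (hL (w, t) ⟨hw, ht⟩).trans (le_max_left _ _)) hy hz

/-- Gronwall's argument for the primitive of e, which vanishes at 0 and has derivative at most L
times itself. -/
theorem eqOn_zero_of_le_mul_integral {e : ℝ → ℝ} (he : Continuous e)
    (he0 : ∀ t, 0 ≤ e t) {L : ℝ} (h : ∀ t ∈ Icc 0 T, e t ≤ L * ∫ s in (0 : ℝ)..t, e s) :
    ∀ t ∈ Icc 0 T, e t = 0 := by
  have hd : ∀ t, HasDerivAt (fun t => ∫ s in (0 : ℝ)..t, e s) (e t) t := fun t =>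
    he.integral_hasStrictDerivAt 0 t |>.hasDerivAt
  have h0 := eq_zero_of_abs_deriv_le_mul_abs_self_of_eq_zero_right (K := L)
    (f := fun t => ∫ s in (0 : ℝ)..t, e s) (a := 0) (b := T)
    (fun t _ => (hd t).continuousAt.continuousWithinAt) (fun t _ => (hd t).hasDerivWithinAt)
    (by simp) (fun t ht => by
      rw [Real.norm_of_nonneg (he0 t), Real.norm_of_nonneg
        (intervalIntegral.integral_nonneg ht.1 fun s _ => he0 s)]
      exact h t (Ico_subset_Icc_self ht))
  intro t ht
  have := h t ht
  rw [h0 t ht, mul_zero] at this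
  exact le_antisymm this (he0 t)

/-- Both solutions stay in one ball, where g and B are Lipschitz in x uniformly in t, and u is
essentially bounded; Gronwall then applies to the norm of the difference. -/
theorem stateMap_zero_unique [CompleteSpace E] (hT : 0 ≤ T) (hg : IsC1InFst T g)
    (hB : IsC1InFst T B) (x0 : E)
    (u : Lp M ∞ ((volume : Measure ℝ).restrict (Icc 0 T))) {ξ η : C(Icc 0 T, E)}
    (hξ : stateMap hT hg hB x0 (u, ξ) = 0) (hη : stateMap hT hg hB x0 (u, η) = 0) : ξ = η := by
  obtain ⟨Lg, hLg0, hLg⟩ := hg.exists_lipschitz (max ‖ξ‖ ‖η‖)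
  obtain ⟨LB, hLB0, hLB⟩ := hB.exists_lipschitz (max ‖ξ‖ ‖η‖)
  set e : ℝ → ℝ := fun s => ‖IccExtend hT ξ s - IccExtend hT η s‖
  have he : Continuous e := (ξ.continuous.Icc_extend'.sub η.continuous.Icc_extend').norm
  have hint : ∀ (ζ : C(Icc 0 T, E)) (t : Icc 0 T), IntervalIntegrable
      (fun s => g (IccExtend hT ζ s) s + B (IccExtend hT ζ s) s (u s)) volume 0 t := fun ζ t =>
    (intervalIntegrable_velocity hT hg hB u ζ).mono_set
      (uIcc_subset_uIcc left_mem_uIcc (by rw [uIcc_of_le hT]; exact t.2))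
  have key : ∀ t ∈ Icc 0 T, e t = 0 := by
    refine eqOn_zero_of_le_mul_integral (L := Lg + LB * ‖u‖) he (fun t => norm_nonneg _) ?_
    intro t ht
    have h1 := congr($hξ ⟨t, ht⟩)
    have h2 := congr($hη ⟨t, ht⟩)
    rw [stateMap_apply, ContinuousMap.zero_apply, sub_sub, sub_eq_zero] at h1 h2
    have h3 : IccExtend hT ξ t - IccExtend hT η t = ∫ s in (0 : ℝ)..t,
        ((g (IccExtend hT ξ s) s + B (IccExtend hT ξ s) s (u s)) -
          (g (IccExtend hT η s) s + B (IccExtend hT η s) s (u s))) := by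
      rw [intervalIntegral.integral_sub (hint ξ ⟨t, ht⟩) (hint η ⟨t, ht⟩),
        IccExtend_of_mem _ _ ht, IccExtend_of_mem _ _ ht, h1, h2]
      abel
    change ‖IccExtend hT ξ t - IccExtend hT η t‖ ≤ _
    rw [h3, ← intervalIntegral.integral_const_mul]
    refine intervalIntegral.norm_integral_le_of_norm_le ht.1 ?_
      ((he.const_mul _).intervalIntegrable _ _)
    have := ae_Ioc_of_ae_Icc (ae_norm_le_Lp_top u) (left_mem_Icc.2 hT) ht
    rw [uIoc_of_le ht.1] at this
    filter_upwards [this] with s hs hst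
    have hsT : s ∈ Icc 0 T := ⟨hst.1.le, hst.2.trans ht.2⟩
    have m1 : IccExtend hT ξ s ∈ Metric.closedBall (0 : E) (max ‖ξ‖ ‖η‖) :=
      mem_closedBall_zero_iff.2 ((ξ.norm_coe_le_norm _).trans (le_max_left _ _))
    have m2 : IccExtend hT η s ∈ Metric.closedBall (0 : E) (max ‖ξ‖ ‖η‖) :=
      mem_closedBall_zero_iff.2 ((η.norm_coe_le_norm _).trans (le_max_right _ _))
    have b1 := hLg s hsT _ m2 _ m1
    have b2 := hLB s hsT _ m2 _ m1
    rw [add_sub_add_comm, ← sub_apply, add_mul]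
    refine (norm_add_le _ _).trans (add_le_add b1 ?_)
    refine (ContinuousLinearMap.le_opNorm _ _).trans ?_
    calc _ ≤ (LB * e s) * ‖u‖ := by
          have := hs hst
          have : 0 ≤ e s := norm_nonneg _
          gcongr
      _ = _ := by ring
  ext1 t
  have := key t t.2
  simpa [e, sub_eq_zero] using this

end Uniqueness

/-! ### Trajectories and the differential of the end-point mapping -/

variable {n m : ℕ} {T : ℝ} {f : Euc n → Euc m → ℝ → Euc n} {x0 : Euc n} {u : Ctrl m T}
  {g : Euc n → ℝ → Euc n} {B : Euc n → ℝ → (Euc m →L[ℝ] Euc n)}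

theorem isTrajectory_trajectory (hu : u ∈ admissible f T x0) :
    IsTrajectory f T x0 u (trajectory f T x0 u) := by
  have h : ∃ x, IsTrajectory f T x0 u x := hu
  rw [trajectory, dif_pos h]
  exact h.choose_spec

theorem isTrajectory_IccExtend (hT : 0 ≤ T) (hg : IsC1InFst T g) (hB : IsC1InFst T B)
    (hf : ∀ x u, ∀ t ∈ Icc (0 : ℝ) T, f x u t = g x t + B x t u) {ξ : C(Icc 0 T, Euc n)}
    (hξ : stateMap hT hg hB x0 (u, ξ) = 0) : IsTrajectory f T x0 u (IccExtend hT ξ) := by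
  have hint := intervalIntegrable_velocity hT hg hB u ξ
  have heq : EqOn (IccExtend hT ξ) (fun t => x0 + ∫ s in (0 : ℝ)..t,
      (g (IccExtend hT ξ s) s + B (IccExtend hT ξ s) s (u s))) (Icc 0 T) := fun t ht => by
    have h1 := congr($hξ ⟨t, ht⟩)
    rw [stateMap_apply, ContinuousMap.zero_apply, sub_sub, sub_eq_zero] at h1
    rw [IccExtend_of_mem _ _ ht, h1]
  refine ⟨?_, ?_, ?_⟩
  · refine AbsolutelyContinuousOnInterval.congr (((absolutelyContinuousOnInterval_const x0 0 T).add
      (hint.absolutelyContinuousOnInterval_integral left_mem_uIcc))) ?_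
    rw [uIcc_of_le hT]
    exact heq.symm
  · simpa using heq (left_mem_Icc.2 hT)
  · refine heq.ae_hasDerivAt_Icc ?_
    filter_upwards [hint.ae_hasDerivAt_integral_Icc hT, ae_restrict_mem measurableSet_Icc]
      with t ht htm
    rw [hf _ _ t htm]
    exact ht.const_add x0

/-- The restriction of an absolutely continuous function, as a continuous map. -/
def restrictIcc (hT : 0 ≤ T) {x : ℝ → Euc n} (hx : AbsolutelyContinuousOnInterval x 0 T) :
    C(Icc 0 T, Euc n) :=
  ⟨fun t => x t, continuousOn_iff_continuous_domRestrict.1 (uIcc_of_le hT ▸ hx.continuousOn)⟩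

theorem restrictIcc_apply (hT : 0 ≤ T) {x : ℝ → Euc n}
    (hx : AbsolutelyContinuousOnInterval x 0 T) (t : Icc 0 T) : restrictIcc hT hx t = x t := rfl

theorem stateMap_restrictIcc (hT : 0 ≤ T) (hg : IsC1InFst T g) (hB : IsC1InFst T B)
    (hf : ∀ x u, ∀ t ∈ Icc (0 : ℝ) T, f x u t = g x t + B x t u) {x : ℝ → Euc n}
    (hx : IsTrajectory f T x0 u x) :
    stateMap hT hg hB x0 (u, restrictIcc hT hx.1) = 0 := by
  ext1 t
  have hder : ∀ᵐ s ∂(volume.restrict (Icc 0 T)), HasDerivAt x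
      (g (IccExtend hT (restrictIcc hT hx.1) s) s +
        B (IccExtend hT (restrictIcc hT hx.1) s) s (u s)) s := by
    filter_upwards [hx.2.2, ae_restrict_mem measurableSet_Icc] with s hs hs'
    rw [IccExtend_of_mem _ _ hs']
    rwa [hf _ _ s hs'] at hs
  have := hx.1.eq_add_integral hT (intervalIntegrable_velocity hT hg hB u _) hder t.2
  rw [stateMap_apply, ContinuousMap.zero_apply, sub_sub, sub_eq_zero]
  exact this.trans (congrArg (· + _) hx.2.1)

/-- The function `trajectory` is defined by a choice; uniqueness pins its values on [0,T]. -/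
theorem trajectory_eq (hT : 0 ≤ T) (hg : IsC1InFst T g) (hB : IsC1InFst T B)
    (hf : ∀ x u, ∀ t ∈ Icc (0 : ℝ) T, f x u t = g x t + B x t u) {ξ : C(Icc 0 T, Euc n)}
    (hξ : stateMap hT hg hB x0 (u, ξ) = 0) (t : Icc 0 T) : trajectory f T x0 u t = ξ t := by
  have h := isTrajectory_trajectory (⟨_, isTrajectory_IccExtend hT hg hB hf hξ⟩ :
    u ∈ admissible f T x0)
  exact congr($(stateMap_zero_unique hT hg hB x0 u (stateMap_restrictIcc hT hg hB hf h) hξ) t)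

/-- The end-point mapping is differentiable at every admissible control; its differential is the
end-point mapping of the linearized system. The linearized system is described by its
fundamental matrix `X` and its inverse `Y`. -/
theorem exists_hasFDerivAt_endpoint (hT : 0 ≤ T) (hg : IsC1InFst T g) (hB : IsC1InFst T B)
    (hf : ∀ x u, ∀ t ∈ Icc (0 : ℝ) T, f x u t = g x t + B x t u) (hu : u ∈ admissible f T x0) :
    ∃ (D : Ctrl m T →L[ℝ] Euc n) (A X Y : ℝ → Euc n →L[ℝ] Euc n),
      HasFDerivAt (endpoint f T x0) D u ∧
      (∀ᵐ t ∂(volume.restrict (Icc 0 T)),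
        fderiv ℝ (fun y => f y (u t) t) (trajectory f T x0 u t) = A t) ∧
      AbsolutelyContinuousOnInterval X 0 T ∧ AbsolutelyContinuousOnInterval Y 0 T ∧
      (∀ᵐ t ∂(volume.restrict (Icc 0 T)), HasDerivAt X (A t ∘L X t) t) ∧
      (∀ᵐ t ∂(volume.restrict (Icc 0 T)), HasDerivAt Y (-(Y t ∘L A t)) t) ∧
      (∀ t ∈ Icc 0 T, X t ∘L Y t = 1) ∧
      (∀ v : Ctrl m T, IntegrableOn (fun s => Y s (B (trajectory f T x0 u s) s (v s))) (Icc 0 T)) ∧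
      ∀ v, D v = X T (∫ s in Icc 0 T, Y s (B (trajectory f T x0 u s) s (v s))) := by
  have hx := isTrajectory_trajectory hu
  set ξ := restrictIcc hT hx.1
  have hξ := stateMap_restrictIcc hT hg hB hf hx
  obtain ⟨ψ, Δ, a, hψ, hev, ha, hΔ⟩ := exists_hasFDerivAt_implicit hT hg hB x0 u ξ hξ
  obtain ⟨X, Y, hX, hY, hX', hY', hXY⟩ := exists_fundamental hT a
  set tT : Icc 0 T := ⟨T, right_mem_Icc.2 hT⟩
  set evT : C(Icc 0 T, Euc n) →L[ℝ] Euc n := ContinuousMap.evalCLM ℝ tT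
  have hYBv : ∀ v : Ctrl m T,
      IntegrableOn (fun s => Y s (B (trajectory f T x0 u s) s (v s))) (Icc 0 T) := by
    intro v
    let YB : C(Icc 0 T, Euc m →L[ℝ] Euc n) := ⟨fun t => Y t ∘L superposition B hB.1 ξ t,
      (continuousOn_iff_continuous_domRestrict.1 (uIcc_of_le hT ▸ hY.continuousOn)).clm_comp
        (superposition B hB.1 ξ).continuous⟩
    refine (integrableOn_bilinear hT (ContinuousLinearMap.id ℝ _) YB v).congr_fun ?_
      measurableSet_Icc
    intro s hs
    simp [IccExtend_of_mem _ _ hs, YB, superposition, ξ, restrictIcc_apply]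
  refine ⟨evT ∘L Δ, a, X, Y, ?_, ?_, hX, hY, hX', hY', hXY, hYBv, ?_⟩
  · refine (evT.hasFDerivAt.comp u hψ).congr_of_eventuallyEq ?_
    filter_upwards [hev] with v hv
    exact trajectory_eq hT hg hB hf hv tT
  · filter_upwards [ha, ae_restrict_mem measurableSet_Icc] with t ht htm
    rw [IccExtend_of_mem _ _ htm] at ht
    simp_rw [hf _ _ t htm]
    exact ht.fderiv
  · intro v
    set ζ : ℝ → Euc n := IccExtend hT (Δ v)
    have hint : IntervalIntegrable (fun s => a s (ζ s) + B (IccExtend hT ξ s) s (v s))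
        volume 0 T := by
      have h1 := intervalIntegrable_bilinear hT
        (ContinuousLinearMap.id ℝ (Euc n →L[ℝ] Euc n)).flip (Δ v) a
        (left_mem_Icc.2 hT) (right_mem_Icc.2 hT)
      have h2 := intervalIntegrable_bilinear hT (ContinuousLinearMap.id ℝ (Euc m →L[ℝ] Euc n))
        (superposition B hB.1 ξ) v (left_mem_Icc.2 hT) (right_mem_Icc.2 hT)
      refine (h1.add h2).congr fun s hs => ?_
      have hs' : s ∈ Icc 0 T := by
        rw [uIoc_of_le hT] at hs; exact Ioc_subset_Icc_self hs
      simp [IccExtend_of_mem _ _ hs', superposition, ζ]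
    have heq : EqOn ζ (fun t => ∫ s in (0 : ℝ)..t, (a s (ζ s) + B (IccExtend hT ξ s) s (v s)))
        (Icc 0 T) := fun t ht =>
      (IccExtend_of_mem _ _ ht).trans (hΔ v ⟨t, ht⟩)
    have hζ : AbsolutelyContinuousOnInterval ζ 0 T := by
      refine (hint.absolutelyContinuousOnInterval_integral left_mem_uIcc).congr ?_
      rw [uIcc_of_le hT]
      exact heq.symm
    have hζ' := heq.ae_hasDerivAt_Icc (hint.ae_hasDerivAt_integral_Icc hT)
    -- Variation of constants: differentiating Y ζ cancels the terms in `a`, leaving Y B v.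
    -- Integrating from ζ(0) = 0 and applying X(T) gives the formula.
    have hYζ := hY.bilinear (ContinuousLinearMap.id ℝ (Euc n →L[ℝ] Euc n)) hζ
    have hYζ' : ∀ᵐ s ∂(volume.restrict (Icc 0 T)), HasDerivAt (fun t => Y t (ζ t))
        (Y s (B (trajectory f T x0 u s) s (v s))) s := by
      filter_upwards [hζ', hY', ae_restrict_mem measurableSet_Icc] with s h1 h2 hs
      convert! h2.clm_apply h1 using 1
      rw [IccExtend_of_mem _ _ hs]
      simp [ξ, restrictIcc_apply]
    have hI : IntervalIntegrable (fun s => Y s (B (trajectory f T x0 u s) s (v s))) volume 0 T := by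
      rw [intervalIntegrable_iff_integrableOn_Icc_of_le hT]
      exact hYBv v
    have h4 := hYζ.eq_add_integral hT hI hYζ' (right_mem_Icc.2 hT)
    have hζ0 : ζ 0 = 0 := by simpa using heq (left_mem_Icc.2 hT)
    simp only [ContinuousLinearMap.id_apply, hζ0, map_zero, zero_add] at h4
    rw [integral_Icc_eq_integral_Ioc, ← intervalIntegral.integral_of_le hT, ← h4,
      ← ContinuousLinearMap.comp_apply (X T), hXY T (right_mem_Icc.2 hT)]
    exact (IccExtend_of_mem hT (Δ v) (right_mem_Icc.2 hT)).symm

/-! ### Linear forms and convex cones -/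

/-- A proper convex cone of a finite-dimensional space is contained in a half-space. -/
theorem exists_nonpos_of_cone_ne_univ {E : Type*} [NormedAddCommGroup E] [NormedSpace ℝ E]
    [FiniteDimensional ℝ E] {C : Set E} (hC : Convex ℝ C) (h0 : (0 : E) ∈ C)
    (hsmul : ∀ r : ℝ, 0 ≤ r → ∀ c ∈ C, r • c ∈ C) (hne : C ≠ univ) :
    ∃ p : E →L[ℝ] ℝ, p ≠ 0 ∧ ∀ c ∈ C, p c ≤ 0 := by
  by_cases hint : (interior C).Nonempty
  · obtain ⟨x, hx⟩ := (ne_univ_iff_exists_notMem C).1 hne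
    obtain ⟨p, hp, hpC⟩ := geometric_hahn_banach_of_nonempty_interior_point hC
      (fun h => hx (interior_subset h)) hint
    refine ⟨p, hp, fun c hc => ?_⟩
    by_contra! hpos
    -- If p c > 0, this multiple of c stays in the cone and has value |p x| + 1, exceeding the bound
    -- p x.
    have h1 := hpC _ (hsmul ((|p x| + 1) / p c) (by positivity) c hc)
    rw [map_smul, smul_eq_mul, div_mul_cancel₀ _ hpos.ne'] at h1
    linarith [le_abs_self (p x)]
  -- As 0 belongs to C, its affine span is its linear span. Empty interior makes this span proper,
  -- and a form vanishing on it will do.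
  · have hspan : Submodule.span ℝ C ≠ ⊤ := fun h => hint <| by
      rw [hC.interior_nonempty_iff_affineSpan_eq_top]
      rw [← SetLike.coe_set_eq, ← insert_eq_of_mem h0, affineSpan_insert_zero, h]
      rfl
    obtain ⟨p, hp, hker⟩ := Submodule.exists_le_ker_of_lt_top _ hspan.lt_top
    refine ⟨LinearMap.toContinuousLinearMap p, by simpa using hp, fun c hc => ?_⟩
    exact (LinearMap.mem_ker.1 (hker (Submodule.subset_span hc))).le

theorem eq_zero_of_forall_nonpos {E : Type*} [NormedAddCommGroup E] [NormedSpace ℝ E]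
    {p : E →L[ℝ] ℝ} (h : ∀ z, p z ≤ 0) : p = 0 := by
  ext z
  have := h (-z)
  rw [map_neg] at this
  exact le_antisymm (h z) (neg_nonpos.1 this)

theorem forall_mem_hull_nonpos {E : Type*} [NormedAddCommGroup E] [NormedSpace ℝ E]
    {S : Set E} {p : E →L[ℝ] ℝ} (h : ∀ z ∈ S, p z ≤ 0) :
    ∀ z ∈ PointedCone.hull ℝ S, p z ≤ 0 := by
  intro z hz
  induction hz using Submodule.span_induction with
  | mem z hz => exact h z hz
  | zero => simp
  | add y z _ _ hy hz => rw [map_add]; linarith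
  | smul r z _ hz =>
    have : r • z = (r : ℝ) • z := rfl
    rw [this, map_smul, smul_eq_mul]
    exact mul_nonpos_of_nonneg_of_nonpos r.2 hz

/-! ### Convexity of the tangent cone -/

section TangentCone

variable {U : Set (Euc m)}

theorem convex_ctrlIn (hU : Convex ℝ U) : Convex ℝ (ctrlIn T U) := by
  intro v hv w hw a b ha hb hab
  have hv' : ∀ᵐ t ∂((volume : Measure ℝ).restrict (Icc 0 T)), v t ∈ U := hv
  have hw' : ∀ᵐ t ∂((volume : Measure ℝ).restrict (Icc 0 T)), w t ∈ U := hw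
  change ∀ᵐ t ∂((volume : Measure ℝ).restrict (Icc 0 T)), (a • v + b • w : Ctrl m T) t ∈ U
  filter_upwards [hv', hw', Lp.coeFn_add (a • v) (b • w), Lp.coeFn_smul a v, Lp.coeFn_smul b w]
    with t h1 h2 h3 h4 h5
  rw [h3, Pi.add_apply, h4, h5]
  exact hU h1 h2 ha hb hab

theorem zero_mem_ctrlTangentCone (hu : u ∈ ctrlIn T U) : 0 ∈ ctrlTangentCone T U u :=
  ⟨0, le_rfl, u, hu, by simp⟩

theorem smul_mem_ctrlTangentCone {r : ℝ} (hr : 0 ≤ r) {v : Ctrl m T}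
    (hv : v ∈ ctrlTangentCone T U u) : r • v ∈ ctrlTangentCone T U u := by
  obtain ⟨α, hα, w, hw, rfl⟩ := hv
  exact ⟨r * α, mul_nonneg hr hα, w, hw, by rw [mul_smul]⟩

/-- A combination of α(v - u) and β(w - u) with weights a, b is aα + bβ times the difference of a
convex combination of v, w and u. If aα + bβ = 0, both terms vanish. -/
theorem convex_ctrlTangentCone (hU : Convex ℝ U) (hu : u ∈ ctrlIn T U) :
    Convex ℝ (ctrlTangentCone T U u) := by
  rintro _ ⟨α, hα, v, hv, rfl⟩ _ ⟨β, hβ, w, hw, rfl⟩ a b ha hb -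
  have h1 := mul_nonneg ha hα
  have h2 := mul_nonneg hb hβ
  rcases (add_nonneg h1 h2).eq_or_lt with h | h
  · have e1 : a * α = 0 := by linarith
    have e2 : b * β = 0 := by linarith
    rw [smul_smul, smul_smul, e1, e2]
    simpa using zero_mem_ctrlTangentCone hu
  · refine ⟨a * α + b * β, h.le, _, convex_ctrlIn hU hv hw (div_nonneg h1 h.le)
      (div_nonneg h2 h.le) (by rw [← add_div, div_self h.ne']), ?_⟩
    rw [smul_sub (a * α + b * β), smul_add, smul_smul _ _ v, smul_smul _ _ w,
      mul_div_cancel₀ _ h.ne', mul_div_cancel₀ _ h.ne']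
    module

end TangentCone

/-! ### Lebesgue points, needle variations and the tangent cone -/

theorem ae_mem_lebesguePoints {φ : ℝ → Euc n} (hφ : IntegrableOn φ (Icc 0 T)) :
    ∀ᵐ τ ∂(volume.restrict (Icc 0 T)), τ ∈ lebesguePoints T φ := by
  set Φ := (Icc 0 T).indicator φ
  have hΦ : Integrable Φ := hφ.integrable_indicator measurableSet_Icc
  have hL := IsUnifLocDoublingMeasure.ae_tendsto_average_norm_sub volume hΦ.locallyIntegrable 1
  rw [← restrict_Ico_eq_restrict_Icc]
  filter_upwards [ae_restrict_of_ae hL, ae_restrict_mem measurableSet_Ico] with τ hτ hτm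
  refine ⟨hτm, ?_⟩
  have h1 := hτ (l := 𝓝[>] (0 : ℝ)) (fun _ => τ) id tendsto_id (by
    filter_upwards [self_mem_nhdsWithin] with r hr
    have : (0 : ℝ) < r := hr
    simp [this.le])
  -- The differentiation theorem divides by the length 2r, whereas `lebesguePoints` divides by r.
  have h2 := h1.const_mul 2
  rw [mul_zero] at h2
  refine squeeze_zero' ?_ ?_ h2
  · filter_upwards [self_mem_nhdsWithin] with r hr
    have : (0 : ℝ) < r := hr
    exact mul_nonneg (inv_nonneg.2 this.le) (integral_nonneg fun _ => norm_nonneg _)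
  · filter_upwards [self_mem_nhdsWithin] with r hr
    have hr : (0 : ℝ) < r := hr
    have hτI := Ico_subset_Icc_self hτm
    rw [id, Real.closedBall_eq_Icc, setAverage_eq, Real.volume_real_Icc_of_le (by linarith),
      smul_eq_mul, ← mul_assoc]
    have e : (2 : ℝ) * (τ + r - (τ - r))⁻¹ = r⁻¹ := by
      rw [show τ + r - (τ - r) = 2 * r by ring]
      field_simp
    rw [e]
    refine mul_le_mul_of_nonneg_left ?_ (inv_nonneg.2 hr.le)
    calc ∫ s in Icc (τ - r) (τ + r) ∩ Icc 0 T, ‖φ s - φ τ‖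
        = ∫ s in Icc (τ - r) (τ + r) ∩ Icc 0 T, ‖Φ s - Φ τ‖ := by
          refine setIntegral_congr_fun (measurableSet_Icc.inter measurableSet_Icc) fun s hs => ?_
          simp only [Φ, indicator_of_mem hs.2, indicator_of_mem hτI]
      _ ≤ _ := by
          refine setIntegral_mono_set ?_ (ae_of_all _ fun _ => norm_nonneg _)
            inter_subset_left.eventuallyLE
          exact ((hΦ.integrableOn).sub (integrableOn_const (by simp))).norm

theorem integrableOn_velocity (hT : 0 ≤ T) (hg : IsC1InFst T g) (hB : IsC1InFst T B)
    (hf : ∀ x u, ∀ t ∈ Icc (0 : ℝ) T, f x u t = g x t + B x t u) (hu : u ∈ admissible f T x0) :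
    IntegrableOn (velocity f T x0 u) (Icc 0 T) := by
  have hx := isTrajectory_trajectory hu
  have h := intervalIntegrable_velocity hT hg hB u (restrictIcc hT hx.1)
  rw [intervalIntegrable_iff_integrableOn_Icc_of_le hT] at h
  refine h.congr_fun (fun s hs => ?_) measurableSet_Icc
  simp only [velocity]
  rw [hf _ _ s hs, IccExtend_of_mem _ _ hs]
  rfl

/-- The strong variation vectors in terms of the fundamental matrix of the linearized system. -/
theorem strongVariationVectors_eq {U : Set (Euc m)}
    (hf : ∀ x u, ∀ t ∈ Icc (0 : ℝ) T, f x u t = g x t + B x t u)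
    {A X Y : ℝ → Euc n →L[ℝ] Euc n}
    (hA : ∀ᵐ t ∂(volume.restrict (Icc 0 T)),
        fderiv ℝ (fun y => f y (u t) t) (trajectory f T x0 u t) = A t)
    (hX : AbsolutelyContinuousOnInterval X 0 T) (hY : AbsolutelyContinuousOnInterval Y 0 T)
    (hX' : ∀ᵐ t ∂(volume.restrict (Icc 0 T)), HasDerivAt X (A t ∘L X t) t)
    (hY' : ∀ᵐ t ∂(volume.restrict (Icc 0 T)), HasDerivAt Y (-(Y t ∘L A t)) t)
    (hXY : ∀ t ∈ Icc 0 T, X t ∘L Y t = 1) :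
    strongVariationVectors f T x0 U u =
      {z | ∃ τ ∈ lebesguePoints T (velocity f T x0 u), ∃ ω ∈ U,
        z = X T (Y τ (B (trajectory f T x0 u τ) τ (ω - u τ)))} := by
  ext z
  refine exists_congr fun τ => and_congr_right fun hτ => exists_congr fun ω =>
    and_congr_right fun _ => ?_
  have hτI : τ ∈ Icc 0 T := Ico_subset_Icc_self hτ.1
  have hT : T ∈ Icc 0 T := ⟨hτI.1.trans hτI.2, le_rfl⟩
  have hsub : Icc τ T ⊆ Icc 0 T := Icc_subset_Icc_left hτI.1
  have husub : uIcc τ T ⊆ uIcc 0 T := by rwa [uIcc_of_le hτI.2, uIcc_of_le hT.1]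
  have hle : volume.restrict (Icc τ T) ≤ volume.restrict (Icc 0 T) := Measure.restrict_mono_set _ hsub
  have hinit : f (trajectory f T x0 u τ) ω τ - f (trajectory f T x0 u τ) (u τ) τ
      = B (trajectory f T x0 u τ) τ (ω - u τ) := by
    rw [hf _ _ _ hτI, hf _ _ _ hτI, map_sub]; abel
  constructor
  · rintro ⟨w, ⟨hw, hw0, hw'⟩, rfl⟩
    -- The function Y w is constant on [τ,T], so w(T) = X(T) Y(τ) w(τ).
    have hc := ((hY.mono husub).bilinear (ContinuousLinearMap.id ℝ (Euc n →L[ℝ] Euc n))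
      hw).sub_eq_of_ae_hasDerivAt (g := fun _ => 0) (f' := fun _ => 0) hτI.2
      (absolutelyContinuousOnInterval_const _ _ _) (by
        filter_upwards [hw', ae_mono hle hA, ae_mono hle hY'] with t h1 h2 h3
        rw [h2] at h1
        convert! h3.clm_apply h1 using 1
        simp) (ae_of_all _ fun t => hasDerivAt_const _ _) (right_mem_Icc.2 hτI.2)
    simp only [ContinuousLinearMap.id_apply, sub_zero] at hc
    rw [← hinit, ← hw0, ← hc, ← ContinuousLinearMap.comp_apply, hXY T hT]
    rfl
  · rintro rfl
    refine ⟨fun t => X t (Y τ (B (trajectory f T x0 u τ) τ (ω - u τ))), ⟨?_, ?_, ?_⟩, rfl⟩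
    · exact (hX.mono husub).bilinear (ContinuousLinearMap.id ℝ (Euc n →L[ℝ] Euc n))
        (absolutelyContinuousOnInterval_const _ _ _)
    · rw [hinit]
      exact congr($(hXY τ hτI) _)
    · filter_upwards [ae_mono hle hA, ae_mono hle hX'] with t h1 h2
      rw [h1]
      convert! h2.clm_apply (hasDerivAt_const t
        (Y τ (B (trajectory f T x0 u τ) τ (ω - u τ)))) using 1
      simp

/-- Averages of `t ↦ Y(t) (F(t) - φ(t))` on the right of a point `τ`, when `Y` and `F` are
continuous and `τ` is a Lebesgue point of `φ`. -/
theorem tendsto_average_of_mem_lebesguePoints {n : ℕ} {T : ℝ} {φ F : ℝ → Euc n}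
    {Y : ℝ → Euc n →L[ℝ] Euc n} (hY : ContinuousOn Y (Icc 0 T)) (hF : ContinuousOn F (Icc 0 T))
    (hφ : IntegrableOn φ (Icc 0 T)) (hint : IntegrableOn (fun s => Y s (F s - φ s)) (Icc 0 T))
    {τ : ℝ} (hτ : τ ∈ lebesguePoints T φ) :
    Tendsto (fun r : ℝ => r⁻¹ • ∫ s in Icc τ (τ + r), Y s (F s - φ s)) (𝓝[>] 0)
      (𝓝 (Y τ (F τ - φ τ))) := by
  obtain ⟨hτm, hleb⟩ := hτ
  have hτI := Ico_subset_Icc_self hτm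
  obtain ⟨C, hC⟩ := isCompact_Icc.exists_bound_of_continuousOn hY
  have hC0 : 0 ≤ C := (norm_nonneg _).trans (hC τ hτI)
  -- The continuous part of the error, vanishing at τ. What remains is Y(s)(φ(s) - φ(τ)), whose
  -- average is controlled by the Lebesgue point property.
  set k : ℝ → Euc n := fun s => Y s (F s) - Y τ (F τ) - (Y s - Y τ) (φ τ)
  have hk : ContinuousOn k (Icc 0 T) :=
    ((hY.clm_apply hF).sub continuousOn_const).sub
      ((hY.sub continuousOn_const).clm_apply continuousOn_const)
  rw [Metric.tendsto_nhds]
  intro ε hε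
  obtain ⟨δ, hδ, hkδ⟩ := Metric.continuousOn_iff.1 hk τ hτI (ε / 2) (half_pos hε)
  have hl := (hleb.const_mul C).eventually_lt_const (u := ε / 2) (by simpa using half_pos hε)
  filter_upwards [hl, Ioo_mem_nhdsGT (lt_min hδ (sub_pos.2 hτm.2))] with r hr1 hr2
  have hr0 : 0 < r := hr2.1
  have hrδ : r < δ := hr2.2.trans_le (min_le_left _ _)
  have hrT : τ + r ≤ T := by linarith [hr2.2.trans_le (min_le_right δ (T - τ))]
  have hsub : Icc τ (τ + r) ⊆ Icc 0 T := Icc_subset_Icc hτI.1 hrT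
  have hvol : volume.real (Icc τ (τ + r)) = r := by
    rw [Real.volume_real_Icc_of_le (by linarith)]; ring
  have hconst : ∀ c : Euc n, IntegrableOn (fun _ => c) (Icc τ (τ + r)) volume := fun c =>
    integrableOn_const (by simp)
  have hφI : IntegrableOn (fun s => ‖φ s - φ τ‖) (Icc 0 T) :=
    (hφ.sub (integrableOn_const (by simp))).norm
  have hdiff : r⁻¹ • ∫ s in Icc τ (τ + r), Y s (F s - φ s) = Y τ (F τ - φ τ) +
      r⁻¹ • ∫ s in Icc τ (τ + r), (Y s (F s - φ s) - Y τ (F τ - φ τ)) := by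
    rw [integral_sub (hint.mono_set hsub) (hconst _), setIntegral_const, hvol, smul_sub,
      inv_smul_smul₀ hr0.ne']
    abel
  rw [hdiff, dist_eq_norm, add_sub_cancel_left, norm_smul, norm_inv, Real.norm_of_nonneg hr0.le]
  have hb : ‖∫ s in Icc τ (τ + r), (Y s (F s - φ s) - Y τ (F τ - φ τ))‖ ≤
      ∫ s in Icc τ (τ + r), (ε / 2 + C * ‖φ s - φ τ‖) := by
    refine norm_integral_le_of_norm_le
      ((integrableOn_const (by simp)).add ((hφI.mono_set hsub).const_mul C)) ?_
    filter_upwards [ae_restrict_mem measurableSet_Icc] with s hs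
    have e : Y s (F s - φ s) - Y τ (F τ - φ τ) = k s - Y s (φ s - φ τ) := by
      simp only [k, map_sub, sub_apply]; abel
    rw [e]
    refine (norm_sub_le _ _).trans (add_le_add ?_ ?_)
    · have h1 := hkδ s (hsub hs) (by
        rw [Real.dist_eq, abs_of_nonneg (by linarith [hs.1])]; linarith [hs.2])
      have h2 : k τ = 0 := by simp [k]
      rw [h2, dist_zero_right] at h1
      exact h1.le
    · exact (ContinuousLinearMap.le_opNorm _ _).trans (by gcongr; exact hC s (hsub hs))
  have hi : ∫ s in Icc τ (τ + r), (ε / 2 + C * ‖φ s - φ τ‖) ≤ r * (ε / 2) +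
      C * ∫ s in Icc (τ - r) (τ + r) ∩ Icc 0 T, ‖φ s - φ τ‖ := by
    have hε2 : Integrable (fun _ : ℝ => ε / 2) (volume.restrict (Icc τ (τ + r))) :=
      integrable_const _
    rw [integral_add hε2 ((hφI.mono_set hsub).const_mul C),
      setIntegral_const, hvol, integral_const_mul, smul_eq_mul]
    gcongr
    · exact ae_of_all _ fun _ => norm_nonneg _
    · exact hφI.mono_set inter_subset_right
    · exact subset_inter (Icc_subset_Icc_left (by linarith)) hsub
  calc _ ≤ r⁻¹ * (r * (ε / 2) + C * ∫ s in Icc (τ - r) (τ + r) ∩ Icc 0 T, ‖φ s - φ τ‖) := by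
        gcongr; exact hb.trans hi
    _ = ε / 2 + C * (r⁻¹ * ∫ s in Icc (τ - r) (τ + r) ∩ Icc 0 T, ‖φ s - φ τ‖) := by
        field_simp
    _ < ε := by linarith

/-- The needle-like variations of an affine system are limits of `L^∞` variations. -/
theorem strongVariationVectors_subset_closure (hT : 0 ≤ T) (hg : IsC1InFst T g)
    (hB : IsC1InFst T B) (hf : ∀ x u, ∀ t ∈ Icc (0 : ℝ) T, f x u t = g x t + B x t u)
    (hu : u ∈ admissible f T x0) {D : Ctrl m T →L[ℝ] Euc n}
    (hD : HasFDerivAt (endpoint f T x0) D u) {U : Set (Euc m)} (huU : u ∈ ctrlIn T U) :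
    strongVariationVectors f T x0 U u ⊆ closure (D '' ctrlTangentCone T U u) := by
  obtain ⟨D', A, X, Y, hD', hA, hX, hY, hX', hY', hXY, hYB, hDv⟩ :=
    exists_hasFDerivAt_endpoint hT hg hB hf hu
  obtain rfl := hD.unique hD'
  rw [strongVariationVectors_eq hf hA hX hY hX' hY' hXY]
  rintro _ ⟨τ, hτ, ω, hω, rfl⟩
  set x := trajectory f T x0 u
  have hx := isTrajectory_trajectory hu
  have hτI : τ ∈ Icc 0 T := Ico_subset_Icc_self hτ.1
  set v0 : Ctrl m T := Lp.const ∞ _ ω - u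
  have hv0 : ∀ᵐ s ∂(volume.restrict (Icc 0 T)), v0 s = ω - u s := by
    filter_upwards [Lp.coeFn_sub (Lp.const ∞ (volume.restrict (Icc 0 T)) ω) u,
      Lp.coeFn_const ∞ (volume.restrict (Icc 0 T)) ω] with s h1 h2
    rw [h1, Pi.sub_apply, h2]; rfl
  have hmem : ∀ r, MemLp ((Icc τ (τ + r)).indicator v0) ∞ (volume.restrict (Icc 0 T)) := fun r =>
    (Lp.memLp v0).indicator measurableSet_Icc
  set F : ℝ → Euc n := fun s => f (x s) ω s
  have hxc : ContinuousOn x (Icc 0 T) := uIcc_of_le hT ▸ hx.1.continuousOn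
  have hpair : ContinuousOn (fun s => (x s, s)) (Icc 0 T) := hxc.prodMk continuousOn_id
  have hmaps : MapsTo (fun s => (x s, s)) (Icc 0 T) (univ ×ˢ Icc 0 T) := fun s hs => ⟨mem_univ _, hs⟩
  have hF : ContinuousOn F (Icc 0 T) :=
    (((hg.1.comp hpair hmaps).add ((hB.1.comp hpair hmaps).clm_apply
      continuousOn_const)).congr fun s hs => hf (x s) ω s hs)
  have hFφ : ∀ s ∈ Icc 0 T, B (x s) s (ω - u s) = F s - velocity f T x0 u s := fun s hs => by
    simp only [F, velocity]
    rw [hf _ _ _ hs, hf _ _ _ hs, map_sub]; abel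
  have hae : ∀ᵐ s ∂(volume.restrict (Icc 0 T)),
      Y s (B (x s) s (v0 s)) = Y s (F s - velocity f T x0 u s) := by
    filter_upwards [hv0, ae_restrict_mem measurableSet_Icc] with s h1 h2
    rw [h1, hFφ s h2]
  have hlim := tendsto_average_of_mem_lebesguePoints (uIcc_of_le hT ▸ hY.continuousOn) hF
    (integrableOn_velocity hT hg hB hf hu) ((hYB v0).congr hae) hτ
  rw [← hFφ τ hτI] at hlim
  have hlim2 := ((X T).continuous.tendsto _).comp hlim
  refine mem_closure_of_tendsto hlim2 ?_
  filter_upwards [Ioo_mem_nhdsGT (sub_pos.2 hτ.1.2)] with r hr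
  have hsub : Icc τ (τ + r) ⊆ Icc 0 T := Icc_subset_Icc hτI.1 (by linarith [hr.2])
  -- The competing control equals ω on [τ, τ+r] and u elsewhere, so it takes its values in U; r⁻¹ is
  -- the cone coefficient, and the image under `D` is the average above.
  refine ⟨r⁻¹ • (hmem r).toLp _, ⟨r⁻¹, inv_nonneg.2 hr.1.le, (hmem r).toLp _ + u, ?_, ?_⟩, ?_⟩
  · have huU' : ∀ᵐ t ∂((volume : Measure ℝ).restrict (Icc 0 T)), u t ∈ U := huU
    change ∀ᵐ t ∂((volume : Measure ℝ).restrict (Icc 0 T)),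
      ((hmem r).toLp _ + u : Ctrl m T) t ∈ U
    filter_upwards [huU', hv0, (hmem r).coeFn_toLp, Lp.coeFn_add ((hmem r).toLp _) u]
      with t h1 h2 h3 h4
    rw [h4, Pi.add_apply, h3]
    by_cases ht : t ∈ Icc τ (τ + r)
    · rw [indicator_of_mem ht, h2, sub_add_cancel]
      exact hω
    · rw [indicator_of_notMem ht, zero_add]
      exact h1
  · rw [add_sub_cancel_right]
  · rw [map_smul, hDv]
    simp only [Function.comp_apply]
    rw [map_smul]
    congr 2
    have e : ∫ s in Icc τ (τ + r), Y s (F s - velocity f T x0 u s) = ∫ s in Icc 0 T,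
        (Icc τ (τ + r)).indicator (fun s => Y s (F s - velocity f T x0 u s)) s := by
      rw [setIntegral_indicator measurableSet_Icc, inter_eq_right.2 hsub]
    rw [e]
    refine integral_congr_ae ?_
    filter_upwards [hae, (hmem r).coeFn_toLp] with s h1 h2
    rw [h2]
    by_cases ht : s ∈ Icc τ (τ + r)
    · rw [indicator_of_mem ht, indicator_of_mem ht, h1]
    · rw [indicator_of_notMem ht, indicator_of_notMem ht, map_zero, map_zero]

/-- A linear form which is nonpositive on the strong `U`-variation vectors is nonpositive on the
image of the tangent cone associated with the convex hull of `U`. -/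
theorem nonpos_on_image_ctrlTangentCone (hT : 0 ≤ T) (hg : IsC1InFst T g) (hB : IsC1InFst T B)
    (hf : ∀ x u, ∀ t ∈ Icc (0 : ℝ) T, f x u t = g x t + B x t u) (hu : u ∈ admissible f T x0)
    {D : Ctrl m T →L[ℝ] Euc n} (hD : HasFDerivAt (endpoint f T x0) D u) {U : Set (Euc m)}
    {p : Euc n →L[ℝ] ℝ} (hp : ∀ z ∈ strongVariationVectors f T x0 U u, p z ≤ 0) :
    ∀ v ∈ ctrlTangentCone T (convexHull ℝ U) u, p (D v) ≤ 0 := by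
  obtain ⟨D', A, X, Y, hD', hA, hX, hY, hX', hY', hXY, hYB, hDv⟩ :=
    exists_hasFDerivAt_endpoint hT hg hB hf hu
  obtain rfl := hD.unique hD'
  rw [strongVariationVectors_eq hf hA hX hY hX' hY' hXY] at hp
  rintro _ ⟨α, hα, w, hw, rfl⟩
  rw [map_smul, map_smul, smul_eq_mul]
  refine mul_nonpos_of_nonneg_of_nonpos hα ?_
  have e : p (D (w - u)) = ∫ s in Icc 0 T,
      (p ∘L X T) (Y s (B (trajectory f T x0 u s) s ((w - u : Ctrl m T) s))) := by
    rw [hDv, ContinuousLinearMap.integral_comp_comm _ (hYB _)]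
    rfl
  rw [e]
  refine integral_nonpos_of_ae ?_
  have hw' : ∀ᵐ t ∂((volume : Measure ℝ).restrict (Icc 0 T)), w t ∈ convexHull ℝ U := hw
  filter_upwards [hw', ae_mem_lebesguePoints (integrableOn_velocity hT hg hB hf hu),
    Lp.coeFn_sub w u] with s h1 h2 h3
  rw [h3, Pi.sub_apply]
  set q : Euc m →L[ℝ] ℝ := (p ∘L X T) ∘L Y s ∘L B (trajectory f T x0 u s) s
  -- At a Lebesgue point s, every ω in U is an admissible needle, so u(s) maximizes q over U up to
  -- membership of u(s) in U. The half-space so obtained is convex and therefore contains conv(U),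
  -- pointwise in s; no decomposition of w into U-valued controls is needed.
  have hq : ∀ ω ∈ U, q ω ≤ q (u s) := fun ω hω => by
    have := hp _ ⟨s, h2, ω, hω, rfl⟩
    have h4 : q (ω - u s) ≤ 0 := this
    rw [map_sub] at h4
    linarith
  have hq2 : convexHull ℝ U ⊆ {ω | q ω ≤ q (u s)} :=
    convexHull_min hq (convex_halfSpace_le q.toLinearMap.isLinear _)
  have h5 : q (w s) ≤ q (u s) := hq2 h1
  change q (w s - u s) ≤ 0
  rw [map_sub]
  linarith

/-! ### The three implications -/

theorem exists_nonpos_of_not_weaklyURegular {U : Set (Euc m)} (hu : u ∈ admissible f T x0)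
    (huU : u ∈ ctrlIn T U) (h : ¬ WeaklyURegular f T x0 U u) :
    ∃ p : Euc n →L[ℝ] ℝ, p ≠ 0 ∧ ∀ z ∈ strongVariationVectors f T x0 U u, p z ≤ 0 := by
  obtain ⟨p, hp, hpC⟩ := exists_nonpos_of_cone_ne_univ
    (C := (pontryaginCone f T x0 U u : Set (Euc n))) (pontryaginCone f T x0 U u).convex
    (zero_mem _) (fun r hr c hc => (pontryaginCone f T x0 U u).smul_mem hr hc)
    (fun h' => h ⟨hu, huU, h'⟩)
  exact ⟨p, hp, fun z hz => hpC z (PointedCone.subset_hull hz)⟩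

/-- The strong variation vectors of a weakly regular control lie in no closed half-space. -/
theorem WeaklyURegular.eq_zero_of_nonpos {U : Set (Euc m)} (h : WeaklyURegular f T x0 U u)
    {p : Euc n →L[ℝ] ℝ} (hp : ∀ z ∈ strongVariationVectors f T x0 U u, p z ≤ 0) : p = 0 :=
  eq_zero_of_forall_nonpos fun z => forall_mem_hull_nonpos hp z
    (show z ∈ (pontryaginCone f T x0 U u : Set (Euc n)) from h.2.2 ▸ mem_univ z)

/-- Otherwise a nonzero form is nonpositive on the needle vectors, hence on the image of the tangent
cone of conv(U), which is the whole space. -/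
theorem StronglyURegular.weaklyURegular (hT : 0 ≤ T) (hf : IsControlAffine T f) {U : Set (Euc m)}
    (huU : u ∈ ctrlIn T U) (h : StronglyURegular f T x0 (convexHull ℝ U) u) :
    WeaklyURegular f T x0 U u := by
  obtain ⟨g, B, hg, hB, hf⟩ := hf
  obtain ⟨hu, -, D, hD, hsurj⟩ := h
  by_contra hcon
  obtain ⟨p, hp, hpV⟩ := exists_nonpos_of_not_weaklyURegular hu huU hcon
  refine hp (eq_zero_of_forall_nonpos fun z => ?_)
  obtain ⟨v, hv, rfl⟩ := hsurj.symm ▸ mem_univ z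
  exact nonpos_on_image_ctrlTangentCone hT hg hB hf hu hD hpV v hv

/-- A nonzero form vanishing on a proper range of `D` would vanish on its closure, hence be
nonpositive on the needle vectors. -/
theorem WeaklyURegular.stronglyRegular (hT : 0 ≤ T) (hf : IsControlAffine T f) {U : Set (Euc m)}
    (h : WeaklyURegular f T x0 U u) : StronglyRegular f T x0 u := by
  obtain ⟨g, B, hg, hB, hf⟩ := hf
  have hu := h.1
  obtain ⟨D, -, -, -, hD, -⟩ := exists_hasFDerivAt_endpoint hT hg hB hf hu
  refine ⟨hu, D, hD, ?_⟩
  by_contra hne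
  have hlt : D.range < ⊤ := lt_top_iff_ne_top.2 fun h' => hne <|
    range_eq_univ.2 (LinearMap.range_eq_top.1 h')
  obtain ⟨p, hp, hker⟩ := Submodule.exists_le_ker_of_lt_top _ hlt
  set q := LinearMap.toContinuousLinearMap p
  have hq : q = 0 := h.eq_zero_of_nonpos fun z hz => by
    have hz := strongVariationVectors_subset_closure hT hg hB hf hu hD h.2.1 hz
    refine closure_minimal (t := {z | q z ≤ 0}) ?_ (isClosed_le q.continuous continuous_const) hz
    rintro _ ⟨v, -, rfl⟩
    exact (LinearMap.mem_ker.1 (hker ⟨v, rfl⟩)).le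
  exact hp (by simpa [q] using hq)

/-- Convexity of U makes the image of the tangent cone convex. If it is proper, a nonzero form is
nonpositive on it, hence on its closure and on the needle vectors. -/
theorem WeaklyURegular.stronglyURegular (hT : 0 ≤ T) (hf : IsControlAffine T f)
    {U : Set (Euc m)} (hU : Convex ℝ U) (h : WeaklyURegular f T x0 U u) :
    StronglyURegular f T x0 U u := by
  obtain ⟨g, B, hg, hB, hf⟩ := hf
  obtain ⟨hu, huU, -⟩ := id h
  obtain ⟨D, -, -, -, hD, -⟩ := exists_hasFDerivAt_endpoint hT hg hB hf hu
  refine ⟨hu, huU, D, hD, ?_⟩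
  by_contra hne
  obtain ⟨p, hp, hpC⟩ := exists_nonpos_of_cone_ne_univ
    ((convex_ctrlTangentCone hU huU).linear_image D.toLinearMap)
    ⟨0, zero_mem_ctrlTangentCone huU, map_zero D⟩
    (by
      rintro r hr _ ⟨v, hv, rfl⟩
      exact ⟨r • v, smul_mem_ctrlTangentCone hr hv, map_smul D r v⟩) hne
  refine hp (h.eq_zero_of_nonpos fun z hz => ?_)
  exact closure_minimal (t := {z | p z ≤ 0}) hpC (isClosed_le p.continuous continuous_const)
    (strongVariationVectors_subset_closure hT hg hB hf hu hD huU hz)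

/-! ### The integrator with nonnegative controls -/

section Counterexample

/-- The end-point mapping of the system `x' = u`, `x(0) = 0` on `[0,1]`. -/
def integratorEndpoint : Ctrl 1 1 →L[ℝ] Euc 1 :=
  ContinuousMap.evalCLM ℝ (⟨1, right_mem_Icc.2 zero_le_one⟩ : Icc (0 : ℝ) 1) ∘L
    volterra zero_le_one (ContinuousLinearMap.id ℝ (Euc 1 →L[ℝ] Euc 1))
      (ContinuousMap.const _ (ContinuousLinearMap.id ℝ (Euc 1)))

theorem integratorEndpoint_apply (v : Ctrl 1 1) :
    integratorEndpoint v = ∫ s in Icc (0 : ℝ) 1, v s := by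
  rw [integral_Icc_eq_integral_Ioc, ← intervalIntegral.integral_of_le zero_le_one]
  rfl

theorem isC1InFst_const {E F : Type*} [NormedAddCommGroup E] [NormedSpace ℝ E]
    [NormedAddCommGroup F] [NormedSpace ℝ F] (T : ℝ) (c : F) :
    IsC1InFst T (fun (_ : E) (_ : ℝ) => c) := by
  refine ⟨continuousOn_const, fun _ _ => differentiable_const c, ?_⟩
  simp only [fderiv_fun_const]
  exact continuousOn_const

theorem isControlAffine_integrator : IsControlAffine 1 fun (_ : Euc 1) (u : Euc 1) _ => u :=
  ⟨fun _ _ => 0, fun _ _ => ContinuousLinearMap.id ℝ _, isC1InFst_const _ _, isC1InFst_const _ _,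
    by simp⟩

theorem stateMap_integrator (v : Ctrl 1 1) :
    stateMap zero_le_one (isC1InFst_const 1 (0 : Euc 1))
      (isC1InFst_const 1 (ContinuousLinearMap.id ℝ (Euc 1))) 0
      (v, volterra zero_le_one (ContinuousLinearMap.id ℝ (Euc 1 →L[ℝ] Euc 1))
        (ContinuousMap.const _ (ContinuousLinearMap.id ℝ (Euc 1))) v) = 0 := by
  ext1 t
  rw [stateMap_apply, volterra_apply]
  simp [IccExtend]

theorem admissible_integrator (v : Ctrl 1 1) :
    v ∈ admissible (fun (_ : Euc 1) (u : Euc 1) _ => u) 1 0 :=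
  ⟨_, isTrajectory_IccExtend zero_le_one _ _ (by simp) (stateMap_integrator v)⟩

theorem endpoint_integrator :
    endpoint (fun (_ : Euc 1) (u : Euc 1) _ => u) 1 0 = integratorEndpoint := by
  ext1 v
  exact trajectory_eq zero_le_one _ _ (by simp) (stateMap_integrator v)
    ⟨1, right_mem_Icc.2 zero_le_one⟩

theorem hasFDerivAt_endpoint_integrator (u : Ctrl 1 1) :
    HasFDerivAt (endpoint (fun (_ : Euc 1) (u : Euc 1) _ => u) 1 0) integratorEndpoint u := by
  rw [endpoint_integrator]
  exact integratorEndpoint.hasFDerivAt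

theorem stronglyRegular_integrator :
    StronglyRegular (fun (_ : Euc 1) (u : Euc 1) _ => u) 1 0 0 := by
  refine ⟨admissible_integrator 0, _, hasFDerivAt_endpoint_integrator 0,
    eq_univ_of_forall fun z => ⟨Lp.const ∞ _ z, ?_⟩⟩
  rw [integratorEndpoint_apply, integral_congr_ae (Lp.coeFn_const ∞ _ z)]
  simp

theorem convex_nonneg_coord : Convex ℝ {ω : Euc 1 | 0 ≤ ω 0} :=
  convex_halfSpace_ge (EuclideanSpace.proj (𝕜 := ℝ) (0 : Fin 1)).toLinearMap.isLinear 0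

/-- At u = 0 the tangent cone consists of nonnegative controls, whose integral is never -1. -/
theorem not_stronglyURegular_integrator :
    ¬ StronglyURegular (fun (_ : Euc 1) (u : Euc 1) _ => u) 1 0 {ω | 0 ≤ ω 0} 0 := by
  rintro ⟨-, -, D, hD, hsurj⟩
  obtain rfl := hD.unique (hasFDerivAt_endpoint_integrator 0)
  obtain ⟨_, ⟨α, hα, w, hw, rfl⟩, hv⟩ :=
    hsurj.symm ▸ mem_univ (EuclideanSpace.single (0 : Fin 1) (-1 : ℝ))
  have h1 : 0 ≤ (EuclideanSpace.proj (𝕜 := ℝ) (0 : Fin 1)) (integratorEndpoint w) := by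
    have hint : IntegrableOn (fun s => w s) (Icc 0 1) :=
      (Lp.memLp w).integrable le_top
    rw [integratorEndpoint_apply, ← ContinuousLinearMap.integral_comp_comm _ hint]
    refine integral_nonneg_of_ae ?_
    have hw' : ∀ᵐ t ∂((volume : Measure ℝ).restrict (Icc 0 1)), 0 ≤ w t 0 := hw
    filter_upwards [hw'] with t ht using ht
  have h2 := congr((EuclideanSpace.proj (𝕜 := ℝ) (0 : Fin 1)) $hv)
  rw [sub_zero, map_smul, map_smul, smul_eq_mul] at h2
  have h3 := mul_nonneg hα h1
  rw [h2] at h3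
  simp at h3
  linarith

end Counterexample

end ControlSystem

end

theorem proposition8 :
    (∀ (n m : ℕ), 0 < n → 0 < m → ∀ (T : ℝ), 0 < T →
      ∀ (x0 : ControlSystem.Euc n) (U : Set (ControlSystem.Euc m))
        (f : ControlSystem.Euc n → ControlSystem.Euc m → ℝ → ControlSystem.Euc n),
        ControlSystem.IsControlAffine T f →
        ∀ u : ControlSystem.Ctrl m T,
          u ∈ ControlSystem.admissible f T x0 ∩ ControlSystem.ctrlIn T U →
          (ControlSystem.StronglyURegular f T x0 (convexHull ℝ U) u →
            ControlSystem.WeaklyURegular f T x0 U u) ∧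
          (ControlSystem.WeaklyURegular f T x0 U u →
            ControlSystem.StronglyRegular f T x0 u) ∧
          (Convex ℝ U →
            (ControlSystem.WeaklyURegular f T x0 U u ↔
              ControlSystem.StronglyURegular f T x0 U u))) ∧
    (∃ (n m : ℕ) (T : ℝ) (x0 : ControlSystem.Euc n) (U : Set (ControlSystem.Euc m))
        (f : ControlSystem.Euc n → ControlSystem.Euc m → ℝ → ControlSystem.Euc n)
        (u : ControlSystem.Ctrl m T),
        0 < n ∧ 0 < m ∧ 0 < T ∧ ControlSystem.IsControlAffine T f ∧
        u ∈ ControlSystem.admissible f T x0 ∩ ControlSystem.ctrlIn T U ∧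
        ControlSystem.StronglyRegular f T x0 u ∧
        ¬ ControlSystem.WeaklyURegular f T x0 U u) := by
  refine ⟨fun n m _ _ T hT x0 U f hf u hu => ⟨fun h => h.weaklyURegular hT.le hf hu.2,
    fun h => h.stronglyRegular hT.le hf, fun hU => ⟨fun h => h.stronglyURegular hT.le hf hU,
    fun h => ?_⟩⟩, ?_⟩
  · refine ControlSystem.StronglyURegular.weaklyURegular hT.le hf hu.2 ?_
    rwa [hU.convexHull_eq]
  -- Since this U is convex, weak regularity would imply strong U-regularity, which fails; the
  -- needle vectors need not be computed.
  · refine ⟨1, 1, 1, 0, {ω | 0 ≤ ω 0}, fun _ u _ => u, 0, one_pos, one_pos, one_pos,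
      ControlSystem.isControlAffine_integrator, ⟨ControlSystem.admissible_integrator 0, ?_⟩,
      ControlSystem.stronglyRegular_integrator, fun h =>
      ControlSystem.not_stronglyURegular_integrator <| h.stronglyURegular zero_le_one
        ControlSystem.isControlAffine_integrator ControlSystem.convex_nonneg_coord⟩
    change ∀ᵐ t ∂((volume : Measure ℝ).restrict (Icc 0 1)),
      (0 : ℝ) ≤ (0 : ControlSystem.Ctrl 1 1) t 0
    filter_upwards [Lp.coeFn_zero (ControlSystem.Euc 1) ∞ (volume.restrict (Icc (0 : ℝ) 1))]
      with t ht
    rw [ht]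
    simp
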